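/- **Quantum registers.** Quantum variables are $r_0,r_1,\dots$. For a finite set $\mathcal V$ of quantum variables let $\mathcal H(\mathcal V)$ be the Hilbert space of functions $\{0,1\}^{\mathcal V}\to\mathbb C$. Fix any sequence $(\mathbf U_i)_{i\in\mathbb N}$ of unitary operators $\mathbf U_i:\mathbb C^{2^{n_i}}\to\mathbb C^{2^{n_i}}$ (for instance an enumeration of all computable ones), with symbols $U_i$. **Terms** of the $\mathsf Q$-calculus, modulo $\alpha$-conversion, are $$M::= x \mid r \mid {!M} \mid 0\mid 1\mid U_i \mid \mathtt{new}(M)\mid M_1M_2\mid \langle M_1,\dots,M_n\rangle \mid \lambda !x.M\mid \lambda\pi.M\qquad(n\ge 2),$$ with $x$ a classical variable, $r$ a quantum variable, and $\pi$ a pattern, i.e. $x$ or $\langle x_1,\dots,x_n\rangle$ with $n\ge2$. An environment $\Gamma$ is a multiset of patterns, of expressions $!x$ and of quantum variables in which each variable name occurs at most once. Well-formed judgements $\Gamma\vdash M$ are generated by: * $\vdash C$ for $C\in\{0,1,U_i\}$; $\ r\vdash r$; $\ x\vdash x$; * from $\Gamma\vdash M$ infer $\Gamma,!x\vdash M$;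 from $\Gamma,!x,!y\vdash M$ infer $\Gamma,!z\vdash M\{z/x,z/y\}$; from $\Gamma,x\vdash M$ infer $\Gamma,!x\vdash M$; * from $!x_1,\dots,!x_m\vdash M$ infer $!x_1,\dots,!x_m\vdash{!M}$; * from $\Gamma,x_1,\dots,x_k\vdash M$ infer $\Gamma,\langle x_1,\dots,x_k\rangle\vdash M$; from $\Gamma_i\vdash M_i$ $(1\le i\le k)$ infer $\Gamma_1,\dots,\Gamma_k\vdash\langle M_1,\dots,M_k\rangle$ ($k\ge2$ in both); * from $\Gamma\vdash M$ infer $\Gamma\vdash\mathtt{new}(M)$; from $\Gamma,\pi\vdash M$ infer $\Gamma\vdash\lambda\pi.M$; from $\Gamma,!x\vdash M$ infer $\Gamma\vdash\lambda!x.M$; from $\Gamma_1\vdash M_1$ and $\Gamma_2\vdash M_2$ infer $\Gamma_1,\Gamma_2\vdash M_1M_2$. **Configurations.** A (well-formed) preconfiguration is a triple $[\mathcal Q,\mathcal{QV},M]$ with $\mathcal{QV}$ a finite set of quantum variables containing those of $M$, $\mathcal Q\in\mathcal H(\mathcal{QV})$, and $\Gamma\vdash M$ well formed for some $\Gamma$.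 A configuration is an equivalence class of preconfigurations up to bijective renaming of the quantum variables in $\mathcal{QV}$ (acting on $\mathcal Q$ and $M$). **Reduction.** The relations $\to_\alpha$ on configurations are induced by the following rules on well-formed preconfigurations, closed under all term contexts except those of the form $!M$ (no reduction takes place under $!$): * $\mathsf{Uq}$: $[\mathcal Q,\mathcal{QV},U\langle r_1,\dots,r_n\rangle]\to[\mathbf U_{\langle\langle r_1,\dots,r_n\rangle\rangle}\mathcal Q,\mathcal{QV},\langle r_1,\dots,r_n\rangle]$ for $U$ the symbol of an operator $\mathbf U$ on $\mathbb C^{2^n}$, $n\ge1$, where $\mathbf U_{\langle\langle r_1,\dots,r_n\rangle\rangle}$ acts as $\mathbf U$ on $r_1,\dots,r_n$ and as the identity on the other variables, and $\langle r_1\rangle$ stands for $r_1$; * $\mathsf{new}$: $[\mathcal Q,\mathcal{QV},\mathtt{new}(c)]\to[\mathcal Q\otimes|r\mapsto c\rangle,\mathcal{QV}\cup\{r\},r]$ with $c\in\{0,1\}$, $r\notin\mathcal{QV}$; * $\mathsf{l}.\beta$: $(\lambda x.M)N\to M\{N/x\}$; $\quad\mathsf{c}.\beta$: $(\lambda!x.M)\,!N\to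 M\{N/x\}$; * $\mathsf{q}.\beta$: $(\lambda\langle x_1,\dots,x_n\rangle.M)\langle r_1,\dots,r_n\rangle\to M\{r_1/x_1,\dots,r_n/x_n\}$ ($n\ge 2$); * $\mathsf{l.cm}$: $L((\lambda\pi.M)N)\to(\lambda\pi.LM)N$; $\quad\mathsf{r.cm}$: $((\lambda\pi.M)N)L\to(\lambda\pi.ML)N$ (without capture of variables of $L$); the last five leave $\mathcal Q$ and $\mathcal{QV}$ unchanged. Let $\mathscr Q=\{\mathsf{Uq},\mathsf q.\beta\}$ (quantum reductions) and $n\mathscr C=\mathscr Q\cup\{\mathsf{new}\}$ (non-classical reductions); the other reductions are classical. Write $C\to_{\mathscr S}D$ if $C\to_\alpha D$ for some $\alpha\in\mathscr S$, and $C\to D$ if $C\to_\alpha D$ for some $\alpha$. **Computations.** A computation of length $\varphi$, $1\le\varphi\le\omega$, is a sequence of configurations $\{C_i\}_{i<\varphi}$ such that $C_{i-1}\to C_i$ for all $0<i<\varphi$ and, if $\varphi$ is finite, $C_{\varphi-1}$ is in normal form (it has no reduct). It is a $\mathsf{CNQ}$ computation if for every $0<i<\varphi-1$: (1) if $C_{i-1}\to_{n\mathscr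 C}C_i$ then $C_i\to_{n\mathscr C}C_{i+1}$; and (2) if $C_{i-1}\to_{\mathscr Q}C_i$ then $C_i\to_{\mathscr Q}C_{i+1}$. That is, all classical reductions come first, then all $\mathsf{new}$ reductions, then all quantum reductions. **Theorem (Standardization).** For every computation $\{C_i\}_{i<\varphi}$ of finite length $\varphi$ there is a $\mathsf{CNQ}$ computation $\{C'_i\}_{i<\xi}$ of finite length $\xi$ such that $C'_0=C_0$ and $C'_{\xi-1}=C_{\varphi-1}$. -/

import Mathlib

noncomputable section

namespace QCalculus

/-! ## Hilbert spaces on quantum variable sets -/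

/-- The Hilbert space `H(V)` of functions `{0,1}^V → ℂ`, for a finite set `V` of quantum
variables; the quantum variables `r₀, r₁, …` are represented by natural numbers. -/
abbrev Hilb (V : Finset ℕ) : Type := EuclideanSpace ℂ (V → Bool)

/-- The assignment `f[r₀ ↦ b₀, …, r_{n-1} ↦ b_{n-1}]` (for distinct `rᵢ`). -/
def override {V : Finset ℕ} {n : ℕ} (f : V → Bool) (r : Fin n → ℕ) (b : Fin n → Bool) :
    V → Bool := by
  classical
  exact fun q => if h : ∃ i, r i = q then b h.choose else f q

/-- The operator `U_{⟨⟨r₀,…,r_{n-1}⟩⟩}` on `H(V)`, for distinct `r₀,…,r_{n-1} ∈ V`: it acts as `U`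
on the variables `r₀,…,r_{n-1}` (in this order) and as the identity on the others. -/
def applyGate {V : Finset ℕ} {n : ℕ} (U : Matrix (Fin n → Bool) (Fin n → Bool) ℂ)
    (r : Fin n → ℕ) (hr : ∀ i, r i ∈ V) (φ : Hilb V) : Hilb V :=
  WithLp.toLp 2 fun f => ∑ b : Fin n → Bool, U (fun i => f ⟨r i, hr i⟩) b * φ (override f r b)

/-- The vector `φ ⊗ |r ↦ c⟩` of `H(V ∪ {r})`, for `r ∉ V`. -/
def addQubit {V : Finset ℕ} (φ : Hilb V) (r : ℕ) (c : Bool) : Hilb (insert r V) :=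
  WithLp.toLp 2 fun f =>
    if f ⟨r, Finset.mem_insert_self r V⟩ = c then
      φ fun q => f ⟨q, Finset.mem_insert_of_mem q.2⟩
    else 0

/-- The action of a bijection `θ : V → V'` of quantum variables on `H(V)`. -/
def mapHilb {V V' : Finset ℕ} (θ : V ≃ V') (φ : Hilb V) : Hilb V' :=
  WithLp.toLp 2 fun g => φ (g ∘ θ)

/-- An interpretation of the gate symbols `U₀, U₁, …`: to each index, a number `n` of qubits and
a unitary operator on `ℂ^(2^n)`, given in the standard basis, which is indexed by `{0,1}^n`. -/
abbrev GateFamily : Type := ℕ → Σ n : ℕ, Matrix.unitaryGroup (Fin n → Bool) ℂ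

/-! ## Terms -/

/-- The shape of a pattern: a variable `x`, or a tuple `⟨x₁,…,x_{n+2}⟩` of variables. -/
inductive Pat : Type
  | var : Pat
  | tup (n : ℕ) : Pat

/-- The number of variables bound by a pattern. -/
def Pat.arity : Pat → ℕ
  | .var => 1
  | .tup n => n + 2

/-- Terms modulo `α`-conversion, in de Bruijn notation. The classical variable `var x` below
binders that bind `k` variables in total is bound if `x < k`, and is the free variable `v_{x-k}`
otherwise. The `i`-th variable of a pattern has index `i` in the body of its abstraction.
Tuples have at least two components: `tuple n M` is `⟨M 0, …, M (n+1)⟩`. -/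
inductive Term : Type
  | var (x : ℕ) : Term
  | qvar (r : ℕ) : Term
  | bang (M : Term) : Term
  | bit (c : Bool) : Term
  | gate (u : ℕ) : Term
  | new (M : Term) : Term
  | app (M N : Term) : Term
  | tuple (n : ℕ) (M : Fin (n + 2) → Term) : Term
  | lamBang (M : Term) : Term
  | lam (p : Pat) (M : Term) : Term

namespace Term

/-- A renaming of free variables, under `k` further bound variables. -/
def liftRen (k : ℕ) (f : ℕ → ℕ) : ℕ → ℕ := fun x => if x < k then x else f (x - k) + k

/-- Renaming of the free classical variables. -/
def rename : (ℕ → ℕ) → Term → Term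
  | f, var x => var (f x)
  | _, qvar r => qvar r
  | f, bang M => bang (M.rename f)
  | _, bit c => bit c
  | _, gate u => gate u
  | f, new M => new (M.rename f)
  | f, app M N => app (M.rename f) (N.rename f)
  | f, tuple n M => tuple n fun i => (M i).rename f
  | f, lamBang M => lamBang (M.rename (liftRen 1 f))
  | f, lam p M => lam p (M.rename (liftRen p.arity f))

/-- The term under `k` further binders. -/
def shift (k : ℕ) (M : Term) : Term := M.rename (· + k)

/-- A simultaneous substitution, under `k` further bound variables. -/
def liftSub (k : ℕ) (σ : ℕ → Term) : ℕ → Term :=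
  fun x => if x < k then var x else (σ (x - k)).shift k

/-- Simultaneous capture-avoiding substitution for the free classical variables. -/
def subst : (ℕ → Term) → Term → Term
  | σ, var x => σ x
  | _, qvar r => qvar r
  | σ, bang M => bang (M.subst σ)
  | _, bit c => bit c
  | _, gate u => gate u
  | σ, new M => new (M.subst σ)
  | σ, app M N => app (M.subst σ) (N.subst σ)
  | σ, tuple n M => tuple n fun i => (M i).subst σ
  | σ, lamBang M => lamBang (M.subst (liftSub 1 σ))
  | σ, lam p M => lam p (M.subst (liftSub p.arity σ))

/-- `M{N₀/x₀,…,N_{k-1}/x_{k-1}}`, where `M` is the body of an abstraction over `x₀,…,x_{k-1}`. -/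
def inst {k : ℕ} (M : Term) (N : Fin k → Term) : Term :=
  M.subst fun x => if h : x < k then N ⟨x, h⟩ else var (x - k)

/-- The set of quantum variables occurring in a term. -/
def qvars : Term → Finset ℕ
  | var _ => ∅
  | qvar r => {r}
  | bang M => M.qvars
  | bit _ => ∅
  | gate _ => ∅
  | new M => M.qvars
  | app M N => M.qvars ∪ N.qvars
  | tuple _ M => Finset.univ.biUnion fun i => (M i).qvars
  | lamBang M => M.qvars
  | lam _ M => M.qvars

/-- Replacement of the quantum variables of a term according to `θ`. -/
def mapQ (θ : ℕ → ℕ) : Term → Term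
  | var x => var x
  | qvar r => qvar (θ r)
  | bang M => bang (M.mapQ θ)
  | bit c => bit c
  | gate u => gate u
  | new M => new (M.mapQ θ)
  | app M N => app (M.mapQ θ) (N.mapQ θ)
  | tuple n M => tuple n fun i => (M i).mapQ θ
  | lamBang M => lamBang (M.mapQ θ)
  | lam p M => lam p (M.mapQ θ)

/-- The term `⟨r₀,…,r_k⟩`; for a single quantum variable, this is `r₀` itself. -/
def qtuple : (k : ℕ) → (Fin (k + 1) → ℕ) → Term
  | 0, r => qvar (r 0)
  | k + 1, r => tuple k fun i => qvar (r i)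

theorem mapQ_congr {f g : ℕ → ℕ} {M : Term} (h : ∀ r ∈ M.qvars, f r = g r) :
    M.mapQ f = M.mapQ g := by
  induction M with
  | var | bit | gate => rfl
  | qvar r => simp only [mapQ]; rw [h r (by simp [qvars])]
  | bang M ih | new M ih | lamBang M ih | lam p M ih =>
    simp only [mapQ]; rw [ih (fun r hr => h r (by simpa [qvars] using hr))]
  | app M N ihM ihN =>
    simp only [mapQ]
    rw [ihM (fun r hr => h r (by simp [qvars, hr])),
      ihN (fun r hr => h r (by simp [qvars, hr]))]
  | tuple n M ih =>
    simp only [mapQ]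
    congr 1
    funext i
    exact ih i (fun r hr => h r (by simpa [qvars] using ⟨i, hr⟩))

theorem mapQ_mapQ (f g : ℕ → ℕ) (M : Term) : (M.mapQ f).mapQ g = M.mapQ (g ∘ f) := by
  induction M <;> simp_all [mapQ]

theorem mapQ_id (M : Term) : M.mapQ id = M := by
  induction M <;> simp_all [mapQ]

end Term

/-! ## Environments and well-formed terms -/

/-- The elements of environments: patterns `x` and `⟨x₁,…,x_{n+2}⟩`, `!x`, quantum variables. -/
inductive EnvItem : Type
  | var (x : ℕ) : EnvItem
  | tup (n : ℕ) (x : Fin (n + 2) → ℕ) : EnvItem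
  | bang (x : ℕ) : EnvItem
  | qvar (r : ℕ) : EnvItem

namespace EnvItem

/-- The classical variables (with repetitions) of an element of an environment. -/
def cnames : EnvItem → Multiset ℕ
  | var x => {x}
  | tup _ x => Finset.univ.val.map x
  | bang x => {x}
  | qvar _ => 0

/-- The quantum variables of an element of an environment. -/
def qnames : EnvItem → Multiset ℕ
  | qvar r => {r}
  | _ => 0

/-- Renumbering under `k` further bound variables. -/
def shift (k : ℕ) : EnvItem → EnvItem
  | var x => var (x + k)
  | tup n x => tup n fun i => x i + k
  | bang x => bang (x + k)
  | qvar r => qvar r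

end EnvItem

abbrev Env : Type := Multiset EnvItem

/-- Each variable name occurs at most once. -/
def Env.Valid (Γ : Env) : Prop := (Γ.bind EnvItem.cnames).Nodup ∧ (Γ.bind EnvItem.qnames).Nodup

def Env.shift (k : ℕ) (Γ : Env) : Env := Γ.map (EnvItem.shift k)

/-- The pattern of shape `p` on the variables `0, 1, …, p.arity - 1`. -/
def Pat.item : Pat → EnvItem
  | .var => .var 0
  | .tup n => .tup n fun i => (i : ℕ)

/-- The well-forming rules: `Judg Γ M` is the derivability of the judgement `Γ ⊢ M`. -/
inductive Judg : Env → Term → Prop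
  | bit (c : Bool) : Judg 0 (.bit c)
  | gate (u : ℕ) : Judg 0 (.gate u)
  | qvar (r : ℕ) : Judg {.qvar r} (.qvar r)
  | var (x : ℕ) : Judg {.var x} (.var x)
  | weak {Γ : Env} {M : Term} (x : ℕ) :
      Judg Γ M → Env.Valid (Γ + {.bang x}) → Judg (Γ + {.bang x}) M
  | contr {Γ : Env} {M : Term} (x y z : ℕ) :
      Judg (Γ + {.bang x} + {.bang y}) M → Env.Valid (Γ + {.bang z}) →
      Judg (Γ + {.bang z}) (M.rename fun v => if v = x ∨ v = y then z else v)
  | prom {Γ : Env} {M : Term} :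
      Judg Γ M → (∀ e ∈ Γ, ∃ x, e = .bang x) → Judg Γ (.bang M)
  | der {Γ : Env} {M : Term} (x : ℕ) : Judg (Γ + {.var x}) M → Judg (Γ + {.bang x}) M
  | tensL {Γ : Env} {M : Term} (n : ℕ) (x : Fin (n + 2) → ℕ) :
      Judg (Γ + Finset.univ.val.map fun i => .var (x i)) M → Judg (Γ + {.tup n x}) M
  | tensR {n : ℕ} {Γ : Fin (n + 2) → Env} {M : Fin (n + 2) → Term} :
      (∀ i, Judg (Γ i) (M i)) → Env.Valid (∑ i, Γ i) → Judg (∑ i, Γ i) (.tuple n M)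
  | new {Γ : Env} {M : Term} : Judg Γ M → Judg Γ (.new M)
  | lam {Γ : Env} {M : Term} (p : Pat) :
      Judg (Env.shift p.arity Γ + {p.item}) M → Judg Γ (.lam p M)
  | lamBang {Γ : Env} {M : Term} :
      Judg (Env.shift 1 Γ + {.bang 0}) M → Judg Γ (.lamBang M)
  | app {Γ Δ : Env} {M N : Term} :
      Judg Γ M → Judg Δ N → Env.Valid (Γ + Δ) → Judg (Γ + Δ) (.app M N)

/-! ## Configurations -/

/-- A triple `[Q, QV, M]`. The condition that the quantum variables of `M` belong to `QV` is part
of `PreConfig.Ok`. -/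
structure PreConfig : Type where
  qv : Finset ℕ
  reg : Hilb qv
  term : Term

/-- `[Q, QV, M]` is a well-formed preconfiguration. -/
def PreConfig.Ok (c : PreConfig) : Prop := c.term.qvars ⊆ c.qv ∧ ∃ Γ, Judg Γ c.term

/-- A map between sets of quantum variables, as a map on names. -/
def extendQ {V V' : Finset ℕ} (θ : V → V') : ℕ → ℕ :=
  fun r => if h : r ∈ V then (θ ⟨r, h⟩ : ℕ) else r

/-- Equivalence of preconfigurations: equality up to a bijective renaming of quantum variables. -/
def PreConfig.Equivalent (c d : PreConfig) : Prop :=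
  ∃ θ : c.qv ≃ d.qv, d.reg = mapHilb θ c.reg ∧ d.term = c.term.mapQ (extendQ θ)

theorem PreConfig.Equivalent.refl (c : PreConfig) : c.Equivalent c := by
  refine ⟨Equiv.refl _, rfl, ?_⟩
  rw [Term.mapQ_congr (g := id), Term.mapQ_id]
  intro r _
  simp [extendQ]

theorem PreConfig.Equivalent.symm {c d : PreConfig} (hc : c.term.qvars ⊆ c.qv)
    (h : c.Equivalent d) : d.Equivalent c := by
  obtain ⟨θ, h1, h2⟩ := h
  refine ⟨θ.symm, ?_, ?_⟩
  · rw [h1]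
    ext f
    simp [mapHilb, Function.comp_assoc]
  · rw [h2, Term.mapQ_mapQ, Term.mapQ_congr (g := id), Term.mapQ_id]
    intro r hr
    simp [extendQ, hc hr]

theorem PreConfig.Equivalent.trans {c d e : PreConfig} (hc : c.term.qvars ⊆ c.qv)
    (h : c.Equivalent d) (h' : d.Equivalent e) : c.Equivalent e := by
  obtain ⟨θ, h1, h2⟩ := h
  obtain ⟨θ', h1', h2'⟩ := h'
  refine ⟨θ.trans θ', ?_, ?_⟩
  · rw [h1', h1]
    ext f
    simp [mapHilb, Function.comp_assoc]
  · rw [h2', h2, Term.mapQ_mapQ]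
    apply Term.mapQ_congr
    intro r hr
    simp [extendQ, hc hr]

instance configSetoid : Setoid {c : PreConfig // c.Ok} where
  r c d := c.1.Equivalent d.1
  iseqv :=
    { refl := fun c => .refl c.1
      symm := fun {c _} h => h.symm c.2.1
      trans := fun {c _ _} h h' => h.trans c.2.1 h' }

/-- (Well-formed) configurations: equivalence classes of well-formed preconfigurations. -/
abbrev Config : Type := Quotient configSetoid

/-! ## Reduction -/

/-- The names of the reduction rules. -/
inductive Label : Type
  | Uq | new | lbeta | qbeta | cbeta | lcm | rcm

/-- The reduction rules on preconfigurations; they are closed under all contexts but `!`. -/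
inductive Step (G : GateFamily) : Label → PreConfig → PreConfig → Prop
  | inTuple {α : Label} {V V' : Finset ℕ} {φ : Hilb V} {φ' : Hilb V'} {n : ℕ}
      {M : Fin (n + 2) → Term} {M' : Term} (i : Fin (n + 2)) :
      Step G α ⟨V, φ, M i⟩ ⟨V', φ', M'⟩ → PreConfig.Ok ⟨V, φ, .tuple n M⟩ →
      Step G α ⟨V, φ, .tuple n M⟩ ⟨V', φ', .tuple n (Function.update M i M')⟩
  | appR {α : Label} {V V' : Finset ℕ} {φ : Hilb V} {φ' : Hilb V'} {M N N' : Term} :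
      Step G α ⟨V, φ, N⟩ ⟨V', φ', N'⟩ → PreConfig.Ok ⟨V, φ, .app M N⟩ →
      Step G α ⟨V, φ, .app M N⟩ ⟨V', φ', .app M N'⟩
  | appL {α : Label} {V V' : Finset ℕ} {φ : Hilb V} {φ' : Hilb V'} {M M' N : Term} :
      Step G α ⟨V, φ, M⟩ ⟨V', φ', M'⟩ → PreConfig.Ok ⟨V, φ, .app M N⟩ →
      Step G α ⟨V, φ, .app M N⟩ ⟨V', φ', .app M' N⟩
  | inNew {α : Label} {V V' : Finset ℕ} {φ : Hilb V} {φ' : Hilb V'} {M M' : Term} :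
      Step G α ⟨V, φ, M⟩ ⟨V', φ', M'⟩ → Step G α ⟨V, φ, .new M⟩ ⟨V', φ', .new M'⟩
  | inLam {α : Label} {V V' : Finset ℕ} {φ : Hilb V} {φ' : Hilb V'} {p : Pat} {M M' : Term} :
      Step G α ⟨V, φ, M⟩ ⟨V', φ', M'⟩ → Step G α ⟨V, φ, .lam p M⟩ ⟨V', φ', .lam p M'⟩
  | inLamBang {α : Label} {V V' : Finset ℕ} {φ : Hilb V} {φ' : Hilb V'} {M M' : Term} :
      Step G α ⟨V, φ, M⟩ ⟨V', φ', M'⟩ → Step G α ⟨V, φ, .lamBang M⟩ ⟨V', φ', .lamBang M'⟩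
  | Uq {V : Finset ℕ} {φ : Hilb V} {u k : ℕ} {U : Matrix.unitaryGroup (Fin (k + 1) → Bool) ℂ}
      {r : Fin (k + 1) → ℕ} (hr : ∀ i, r i ∈ V) :
      PreConfig.Ok ⟨V, φ, .app (.gate u) (.qtuple k r)⟩ → G u = ⟨k + 1, U⟩ →
      Step G .Uq ⟨V, φ, .app (.gate u) (.qtuple k r)⟩ ⟨V, applyGate U.1 r hr φ, .qtuple k r⟩
  | new {V : Finset ℕ} {φ : Hilb V} {c : Bool} {r : ℕ} :
      PreConfig.Ok ⟨V, φ, .new (.bit c)⟩ → r ∉ V →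
      Step G .new ⟨V, φ, .new (.bit c)⟩ ⟨insert r V, addQubit φ r c, .qvar r⟩
  | lbeta {V : Finset ℕ} {φ : Hilb V} {M N : Term} :
      PreConfig.Ok ⟨V, φ, .app (.lam .var M) N⟩ →
      Step G .lbeta ⟨V, φ, .app (.lam .var M) N⟩ ⟨V, φ, M.inst (k := 1) fun _ => N⟩
  | qbeta {V : Finset ℕ} {φ : Hilb V} {n : ℕ} {M : Term} {r : Fin (n + 2) → ℕ} :
      PreConfig.Ok ⟨V, φ, .app (.lam (.tup n) M) (.tuple n fun i => .qvar (r i))⟩ →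
      Step G .qbeta ⟨V, φ, .app (.lam (.tup n) M) (.tuple n fun i => .qvar (r i))⟩
        ⟨V, φ, M.inst fun i => .qvar (r i)⟩
  | cbeta {V : Finset ℕ} {φ : Hilb V} {M N : Term} :
      PreConfig.Ok ⟨V, φ, .app (.lamBang M) (.bang N)⟩ →
      Step G .cbeta ⟨V, φ, .app (.lamBang M) (.bang N)⟩ ⟨V, φ, M.inst (k := 1) fun _ => N⟩
  | lcm {V : Finset ℕ} {φ : Hilb V} {p : Pat} {L M N : Term} :
      PreConfig.Ok ⟨V, φ, .app L (.app (.lam p M) N)⟩ →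
      Step G .lcm ⟨V, φ, .app L (.app (.lam p M) N)⟩
        ⟨V, φ, .app (.lam p (.app (L.shift p.arity) M)) N⟩
  | rcm {V : Finset ℕ} {φ : Hilb V} {p : Pat} {L M N : Term} :
      PreConfig.Ok ⟨V, φ, .app (.app (.lam p M) N) L⟩ →
      Step G .rcm ⟨V, φ, .app (.app (.lam p M) N) L⟩
        ⟨V, φ, .app (.lam p (.app M (L.shift p.arity))) N⟩

/-- The reduction relation `→_α` on configurations. -/
def Red (G : GateFamily) (α : Label) (C D : Config) : Prop :=
  ∃ c d : {c : PreConfig // c.Ok}, ⟦c⟧ = C ∧ ⟦d⟧ = D ∧ Step G α c.1 d.1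

/-- The reduction relation `→_S`, for a set `S` of labels. -/
def RedIn (G : GateFamily) (S : Set Label) (C D : Config) : Prop := ∃ α ∈ S, Red G α C D

/-- The labels of quantum reductions. -/
def quantumLabels : Set Label := {.Uq, .qbeta}

/-- The labels of non classical reductions; the other labels are the classical ones. -/
def nonClassicalLabels : Set Label := quantumLabels ∪ {.new}

def NormalForm (G : GateFamily) (C : Config) : Prop := ¬ ∃ D, RedIn G Set.univ C D

/-- `C₀, C₁, …` (only the `Cᵢ` with `i < len` matter) is a computation of length
`1 ≤ len ≤ ω`: each `Cᵢ` reduces to `Cᵢ₊₁`, and the last configuration, if any, is normal. -/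
def IsComputation (G : GateFamily) (len : ℕ∞) (C : ℕ → Config) : Prop :=
  0 < len ∧
  (∀ i : ℕ, ((i + 1 : ℕ) : ℕ∞) < len → RedIn G Set.univ (C i) (C (i + 1))) ∧
  (len = ⊤ ∨ ∃ l : ℕ, len = ((l + 1 : ℕ) : ℕ∞) ∧ NormalForm G (C l))

/-- A CNQ computation: a computation in which a non classical reduction is only followed by non
classical ones, and a quantum reduction is only followed by quantum ones. -/
def IsCNQ (G : GateFamily) (len : ℕ∞) (C : ℕ → Config) : Prop :=
  IsComputation G len C ∧
  (∀ i : ℕ, ((i + 2 : ℕ) : ℕ∞) < len →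
    RedIn G nonClassicalLabels (C i) (C (i + 1)) →
    RedIn G nonClassicalLabels (C (i + 1)) (C (i + 2))) ∧
  (∀ i : ℕ, ((i + 2 : ℕ) : ℕ∞) < len →
    RedIn G quantumLabels (C i) (C (i + 1)) → RedIn G quantumLabels (C (i + 1)) (C (i + 2)))

end QCalculus

end

/-! The proof sorts a computation by exchanging adjacent reductions. Two exchanges suffice. A non
classical step followed by a classical one can be replaced by finitely many classical steps followed
by one non classical step (`Classical.permute`). A quantum step followed by a `new` step can be
replaced by a `new` step followed by a quantum step (`Quantum.permute_new`). In both cases the step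
that is moved to the right remains a single step, so `exists_permutation` sorts every finite
reduction by plain induction, without a termination argument.

The first exchange rests on linearity. Only the content of a `!` is ever copied or erased, and
nothing reduces there, so a classical step may move a non classical redex but neither duplicates nor
discards it. Conversely, `Uq` and `new` produce only tuples of quantum variables, which create no
classical redex. A `qbeta` step substitutes only quantum variables, so a classical redex inside its
result was already present in the body of the abstraction (`Ctx.reflect`). A redex formed by the
result together with its surroundings is obtained beforehand by moving the surroundings into the
body with `lcm` and `rcm`. The second exchange holds because a quantum step never produces a bit
(`Quantum.ne_bit`).

Well-formedness is handled by counting: a term has a judgement if and only if each pattern-bound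
variable occurs exactly once, outside every `!` within its scope, and each quantum variable occurs
at most once and under no `!` (`exists_judg_iff`). With occurrences under `!` counted twice, both
conditions bound a weight by `1`, and such weights are easily followed along reductions.

The CNQ conditions only ask whether some reduction of a given kind links two configurations. The
sorted sequence satisfies them because one pair of configurations cannot be linked by two kinds:
`new` changes the number of quantum variables, and classical and quantum steps from one term have
different results (`Ctx.classical_ne_quantum`). -/

noncomputable section
namespace QCalculus
namespace Term

/-! ## The substitution calculus -/

theorem liftRen_comp (k : ℕ) (f g : ℕ → ℕ) : liftRen k g ∘ liftRen k f = liftRen k (g ∘ f) := by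
  funext x
  by_cases hx : x < k <;> simp [liftRen, hx]

theorem liftRen_id (k : ℕ) : liftRen k id = id := by
  funext x
  by_cases hx : x < k
  · simp [liftRen, hx]
  · simp [liftRen, hx]; omega

theorem rename_id (M : Term) : M.rename id = M := by
  induction M <;> simp_all [rename, liftRen_id]

theorem rename_rename (f g : ℕ → ℕ) (M : Term) : (M.rename f).rename g = M.rename (g ∘ f) := by
  induction M generalizing f g <;> simp_all [rename, liftRen_comp]

theorem liftSub_comp_liftRen (k : ℕ) (f : ℕ → ℕ) (σ : ℕ → Term) :
    liftSub k σ ∘ liftRen k f = liftSub k (σ ∘ f) := by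
  funext x
  by_cases hx : x < k <;> simp [liftRen, liftSub, hx]

theorem rename_subst (f : ℕ → ℕ) (σ : ℕ → Term) (M : Term) :
    (M.rename f).subst σ = M.subst (σ ∘ f) := by
  induction M generalizing f σ <;> simp_all [rename, subst, liftSub_comp_liftRen]

theorem shift_rename (k : ℕ) (f : ℕ → ℕ) (M : Term) :
    (M.shift k).rename (liftRen k f) = (M.rename f).shift k := by
  rw [shift, shift, rename_rename, rename_rename]
  congr 1
  funext x
  simp [liftRen]

theorem liftSub_rename (k : ℕ) (f : ℕ → ℕ) (σ : ℕ → Term) :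
    (fun x => (liftSub k σ x).rename (liftRen k f)) = liftSub k fun x => (σ x).rename f := by
  funext x
  by_cases hx : x < k
  · simp [liftSub, hx, rename, liftRen]
  · simp [liftSub, hx, shift_rename]

theorem subst_rename (f : ℕ → ℕ) (σ : ℕ → Term) (M : Term) :
    (M.subst σ).rename f = M.subst fun x => (σ x).rename f := by
  induction M generalizing f σ <;> simp_all [rename, subst, liftSub_rename]

theorem shift_subst (k : ℕ) (σ : ℕ → Term) (M : Term) :
    (M.shift k).subst (liftSub k σ) = (M.subst σ).shift k := by
  rw [shift, shift, rename_subst, subst_rename]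
  congr 1
  funext x
  simp [liftSub, shift]

theorem liftSub_subst (k : ℕ) (σ τ : ℕ → Term) :
    (fun x => (liftSub k σ x).subst (liftSub k τ)) = liftSub k fun x => (σ x).subst τ := by
  funext x
  by_cases hx : x < k
  · simp [liftSub, hx, subst]
  · simp [liftSub, hx, ← shift_subst]

theorem subst_subst (σ τ : ℕ → Term) (M : Term) :
    (M.subst σ).subst τ = M.subst fun x => (σ x).subst τ := by
  induction M generalizing σ τ <;> simp_all [subst, liftSub_subst]

theorem liftSub_var (k : ℕ) (f : ℕ → ℕ) :
    liftSub k (fun x => var (f x)) = fun x => var (liftRen k f x) := by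
  funext x
  by_cases hx : x < k <;> simp [liftSub, liftRen, hx, shift, rename]

theorem subst_var_comp (f : ℕ → ℕ) (M : Term) : M.subst (fun x => var (f x)) = M.rename f := by
  induction M generalizing f <;> simp_all [rename, subst, liftSub_var]

theorem subst_var (M : Term) : M.subst var = M := by
  simpa [rename_id] using subst_var_comp id M

theorem shift_inst {k : ℕ} (M : Term) (N : Fin k → Term) : (M.shift k).inst N = M := by
  rw [inst, shift, rename_subst]
  convert subst_var M using 2
  funext x
  simp

theorem inst_subst {k : ℕ} (M : Term) (N : Fin k → Term) (σ : ℕ → Term) :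
    (M.inst N).subst σ = (M.subst (liftSub k σ)).inst fun i => (N i).subst σ := by
  rw [inst, subst_subst, inst, subst_subst]
  congr 1
  funext x
  by_cases hx : x < k
  · simp [liftSub, hx, subst]
  · have := shift_inst (σ (x - k)) fun i => (N i).subst σ
    simp only [inst] at this
    simp [liftSub, hx, subst, this]

theorem qtuple_subst (k : ℕ) (r : Fin (k + 1) → ℕ) (σ : ℕ → Term) :
    (qtuple k r).subst σ = qtuple k r := by
  cases k <;> rfl

theorem mapQ_rename (θ f : ℕ → ℕ) (M : Term) :
    (M.rename f).mapQ θ = (M.mapQ θ).rename f := by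
  induction M generalizing f <;> simp_all [mapQ, rename]

theorem liftSub_mapQ (θ : ℕ → ℕ) (k : ℕ) (σ : ℕ → Term) :
    (fun x => (liftSub k σ x).mapQ θ) = liftSub k fun x => (σ x).mapQ θ := by
  funext x
  by_cases hx : x < k <;> simp [liftSub, hx, mapQ, shift, mapQ_rename]

theorem mapQ_subst (θ : ℕ → ℕ) (σ : ℕ → Term) (M : Term) :
    (M.subst σ).mapQ θ = (M.mapQ θ).subst fun x => (σ x).mapQ θ := by
  induction M generalizing σ <;> simp_all [mapQ, subst, liftSub_mapQ]

theorem mapQ_inst {k : ℕ} (θ : ℕ → ℕ) (M : Term) (N : Fin k → Term) :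
    (M.inst N).mapQ θ = (M.mapQ θ).inst fun i => (N i).mapQ θ := by
  rw [inst, mapQ_subst, inst]
  congr 1
  funext x
  by_cases hx : x < k <;> simp [hx, mapQ]

theorem mapQ_qtuple (θ : ℕ → ℕ) (k : ℕ) (r : Fin (k + 1) → ℕ) :
    (qtuple k r).mapQ θ = qtuple k (θ ∘ r) := by
  cases k <;> rfl

/-! ## Weighted occurrence counting -/

/-- Weights of variables, under `k` further bound variables of weight `0`. -/
def under (k : ℕ) (w : ℕ → ℕ) : ℕ → ℕ := fun x => if x < k then 0 else w (x - k)

/-- The total weight of a term, where gates and abstractions over tuples weigh `a`, a quantum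
variable `r` weighs `v r`, a free classical variable `x` weighs `w x`, and everything inside
a `bang` counts twice. -/
def wt (a : ℕ) (v : ℕ → ℕ) : (ℕ → ℕ) → Term → ℕ
  | w, var x => w x
  | _, qvar r => v r
  | w, bang M => 2 * M.wt a v w
  | _, bit _ => 0
  | _, gate _ => a
  | w, new M => M.wt a v w
  | w, app M N => M.wt a v w + N.wt a v w
  | w, tuple _ M => ∑ i, (M i).wt a v w
  | w, lamBang M => M.wt a v (under 1 w)
  | w, lam .var M => M.wt a v (under 1 w)
  | w, lam (.tup n) M => a + M.wt a v (under (n + 2) w)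

/-- The number of free occurrences of `x`; it is `1` if and only if `x` is used linearly. -/
def occ (x : ℕ) (M : Term) : ℕ := M.wt 0 0 (Pi.single x 1)

/-- The number of occurrences of the quantum variable `r`, counting twice those inside a bang. -/
def qocc (r : ℕ) (M : Term) : ℕ := M.wt 0 (Pi.single r 1) 0

/-- All variables bound by patterns are used linearly. -/
def LamOK : Term → Prop
  | var _ => True
  | qvar _ => True
  | bang M => M.LamOK
  | bit _ => True
  | gate _ => True
  | new M => M.LamOK
  | app M N => M.LamOK ∧ N.LamOK
  | tuple _ M => ∀ i, (M i).LamOK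
  | lamBang M => M.LamOK
  | lam p M => M.LamOK ∧ ∀ i < p.arity, M.occ i = 1

theorem under_comp_liftRen (k : ℕ) (w f : ℕ → ℕ) :
    under k w ∘ liftRen k f = under k (w ∘ f) := by
  funext x
  by_cases hx : x < k <;> simp [under, liftRen, hx]

theorem under_zero (k : ℕ) : under k 0 = 0 := by
  funext x
  simp [under]

theorem under_comp_shift (k : ℕ) (w : ℕ → ℕ) : under k w ∘ (· + k) = w := by
  funext x
  simp [under]

theorem under_single (k x : ℕ) : under k (Pi.single x 1) = Pi.single (x + k) 1 := by
  funext y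
  by_cases hy : y < k
  · have : y ≠ x + k := by omega
    simp [under, hy, this]
  · by_cases h : y = x + k
    · simp [under, h]
    · have : y - k ≠ x := by omega
      simp [under, hy, h, this]

theorem under_add (k : ℕ) (w w' : ℕ → ℕ) : under k (w + w') = under k w + under k w' := by
  funext x
  by_cases hx : x < k <;> simp [under, hx]

theorem wt_rename (a : ℕ) (v w f : ℕ → ℕ) (M : Term) :
    (M.rename f).wt a v w = M.wt a v (w ∘ f) := by
  induction M generalizing w f with
  | lam p M ih => cases p <;> simp [rename, wt, ih, under_comp_liftRen, Pat.arity]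
  | _ => simp_all [rename, wt, under_comp_liftRen]

theorem wt_shift (a : ℕ) (v w : ℕ → ℕ) (k : ℕ) (M : Term) :
    (M.shift k).wt a v (under k w) = M.wt a v w := by
  rw [shift, wt_rename, under_comp_shift]

theorem wt_liftSub (a : ℕ) (v w : ℕ → ℕ) (k : ℕ) (σ : ℕ → Term) :
    (fun x => (liftSub k σ x).wt a v (under k w)) = under k fun x => (σ x).wt a v w := by
  funext x
  by_cases hx : x < k
  · simp [liftSub, hx, wt, under]
  · simp only [liftSub, hx, if_false, wt_shift]
    simp [under, hx]

theorem wt_subst (a : ℕ) (v w : ℕ → ℕ) (σ : ℕ → Term) (M : Term) :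
    (M.subst σ).wt a v w = M.wt a v fun x => (σ x).wt a v w := by
  induction M generalizing w σ with
  | lam p M ih => cases p <;> simp [subst, wt, ih, wt_liftSub, Pat.arity]
  | _ => simp_all [subst, wt, wt_liftSub]

theorem wt_add (a a' : ℕ) (v v' w w' : ℕ → ℕ) (M : Term) :
    M.wt (a + a') (v + v') (w + w') = M.wt a v w + M.wt a' v' w' := by
  induction M generalizing w w' with
  | lam p M ih => cases p <;> simp [wt, ih, under_add]; ring
  | _ => simp_all [wt, under_add, Finset.sum_add_distrib] <;> ring

theorem wt_zero (M : Term) : M.wt 0 0 0 = 0 := by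
  -- At zero weights additivity says that the weight is its own double.
  have := wt_add 0 0 0 0 0 0 M
  simp only [add_zero] at this
  omega

/-- The weight of the free classical variables is additive. -/
def wtHom (M : Term) : (ℕ → ℕ) →+ ℕ where
  toFun w := M.wt 0 0 w
  map_zero' := wt_zero M
  map_add' w w' := wt_add 0 0 0 0 w w' M

/-- After a substitution, a variable weighs as much as the term put in its place, and weights are
additive in the weights of variables. Each argument is thus counted once per occurrence, which means
exactly once for a linear pattern. -/
theorem wt_inst {k : ℕ} (a : ℕ) (v w : ℕ → ℕ) (M : Term) (N : Fin k → Term) :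
    (M.inst N).wt a v w =
      M.wt a v (under k w) + ∑ i : Fin k, M.occ i * (N i).wt a v w := by
  rw [inst, wt_subst]
  -- The weights split into those of the outer variables and a multiple of the indicator of each
  -- bound variable.
  have h : (fun x => (if h : x < k then N ⟨x, h⟩ else var (x - k)).wt a v w) =
      under k w + ∑ i : Fin k, (N i).wt a v w • Pi.single (i : ℕ) 1 := by
    funext x
    simp only [Pi.add_apply, Finset.sum_apply, Pi.smul_apply]
    by_cases hx : x < k
    · rw [Finset.sum_eq_single (⟨x, hx⟩ : Fin k)]
      · simp [under, hx]
      · intro b _ hb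
        have : x ≠ (b : ℕ) := fun h => hb (Fin.ext h.symm)
        simp [this]
      · simp
    · rw [Finset.sum_eq_zero]
      · simp [under, hx, wt]
      · intro b _
        have : x ≠ (b : ℕ) := by omega
        simp [this]
  rw [h]
  have h2 := wt_add a 0 v 0 (under k w) (∑ i : Fin k, (N i).wt a v w • Pi.single (i : ℕ) 1) M
  simp only [add_zero] at h2
  rw [h2]
  congr 1
  have h3 := map_sum (wtHom M) (fun i : Fin k => (N i).wt a v w • (Pi.single (i : ℕ) 1 : ℕ → ℕ))
    Finset.univ
  refine h3.trans (Finset.sum_congr rfl fun i _ => ?_)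
  rw [map_nsmul, smul_eq_mul, mul_comm]
  rfl

theorem occ_lam (x : ℕ) (p : Pat) (M : Term) : (lam p M).occ x = M.occ (x + p.arity) := by
  cases p <;> simp [occ, wt, under_single, Pat.arity]

theorem occ_lamBang (x : ℕ) (M : Term) : (lamBang M).occ x = M.occ (x + 1) := by
  simp [occ, wt, under_single]

theorem wt_eq_of_occ {w w' : ℕ → ℕ} (a : ℕ) (v : ℕ → ℕ) (M : Term)
    (h : ∀ x, M.occ x ≠ 0 → w x = w' x) : M.wt a v w = M.wt a v w' := by
  induction M generalizing w w' with
  | var x => exact h x (by simp [occ, wt])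
  | qvar | bit | gate => rfl
  | bang M ih | new M ih =>
    simp only [wt]
    rw [ih fun x hx => h x (by simpa [occ, wt] using hx)]
  | app M N ihM ihN =>
    simp only [wt]
    rw [ihM fun x hx => h x (by simp only [occ, wt] at *; omega),
      ihN fun x hx => h x (by simp only [occ, wt] at *; omega)]
  | tuple n M ih =>
    simp only [wt]
    refine Finset.sum_congr rfl fun i _ => ih i fun x hx => h x ?_
    simp only [occ, wt] at *
    intro h0
    exact hx (by simpa using (Finset.sum_eq_zero_iff.1 h0) i (Finset.mem_univ i))
  | lamBang M ih =>
    simp only [wt]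
    refine ih fun x hx => ?_
    by_cases hk : x < 1
    · simp [under, hk]
    · simp only [under, hk, if_false]
      exact h _ (by rwa [occ_lamBang, Nat.sub_add_cancel (by omega)])
  | lam p M ih =>
    have : M.wt a v (under p.arity w) = M.wt a v (under p.arity w') := by
      refine ih fun x hx => ?_
      by_cases hk : x < p.arity
      · simp [under, hk]
      · simp only [under, hk, if_false]
        exact h _ (by rwa [occ_lam, Nat.sub_add_cancel (by omega)])
    cases p <;> simp only [wt] <;> simpa [Pat.arity] using this

theorem subst_congr {σ τ : ℕ → Term} (M : Term) (h : ∀ x, M.occ x ≠ 0 → σ x = τ x) :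
    M.subst σ = M.subst τ := by
  induction M generalizing σ τ with
  | var x => exact h x (by simp [occ, wt])
  | qvar | bit | gate => rfl
  | bang M ih | new M ih =>
    simp only [subst]
    rw [ih fun x hx => h x (by simpa [occ, wt] using hx)]
  | app M N ihM ihN =>
    simp only [subst]
    rw [ihM fun x hx => h x (by simp only [occ, wt] at *; omega),
      ihN fun x hx => h x (by simp only [occ, wt] at *; omega)]
  | tuple n M ih =>
    simp only [subst]
    congr 1
    funext i
    refine ih i fun x hx => h x ?_
    simp only [occ, wt] at *
    intro h0
    exact hx (by simpa using (Finset.sum_eq_zero_iff.1 h0) i (Finset.mem_univ i))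
  | lamBang M ih =>
    simp only [subst]
    rw [ih fun x hx => ?_]
    by_cases hk : x < 1
    · simp [liftSub, hk]
    · simp only [liftSub, hk, if_false]
      rw [h _ (by rwa [occ_lamBang, Nat.sub_add_cancel (by omega)])]
  | lam p M ih =>
    simp only [subst]
    rw [ih fun x hx => ?_]
    by_cases hk : x < p.arity
    · simp [liftSub, hk]
    · simp only [liftSub, hk, if_false]
      rw [h _ (by rwa [occ_lam, Nat.sub_add_cancel (by omega)])]

theorem rename_congr {f g : ℕ → ℕ} (M : Term) (h : ∀ x, M.occ x ≠ 0 → f x = g x) :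
    M.rename f = M.rename g := by
  rw [← subst_var_comp, ← subst_var_comp]
  exact subst_congr M fun x hx => by rw [h x hx]

theorem wt_qtuple (a : ℕ) (v w : ℕ → ℕ) (k : ℕ) (r : Fin (k + 1) → ℕ) :
    (qtuple k r).wt a v w = ∑ i, v (r i) := by
  cases k <;> simp [qtuple, wt]

theorem wt_mapQ (a : ℕ) (v w θ : ℕ → ℕ) (M : Term) :
    (M.mapQ θ).wt a v w = M.wt a (v ∘ θ) w := by
  induction M generalizing w with
  | lam p M ih => cases p <;> simp [mapQ, wt, ih]
  | _ => simp_all [mapQ, wt]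

theorem mem_qvars {r : ℕ} {M : Term} : r ∈ M.qvars ↔ M.qocc r ≠ 0 := by
  induction M with
  | lam p M ih => cases p <;> simp_all [qvars, qocc, wt, under_zero]
  | qvar s => simp [qvars, qocc, wt, Pi.single_apply, eq_comm]
  | app M N h1 h2 =>
    simp only [qvars, Finset.mem_union, h1, h2]
    simp only [qocc, wt]
    omega
  | _ => simp_all [qvars, qocc, wt, under_zero]

/-! ### Stability of linear patterns -/

theorem LamOK.rename {M : Term} (h : M.LamOK) (f : ℕ → ℕ) : (M.rename f).LamOK := by
  induction M generalizing f with
  | lam p M ih =>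
    refine ⟨ih h.1 _, fun i hi => ?_⟩
    rw [occ, wt_rename]
    refine Eq.trans ?_ (h.2 i hi)
    rw [occ]
    congr 1
    funext x
    by_cases hx : x < p.arity
    · simp [liftRen, hx]
    · have h1 : f (x - p.arity) + p.arity ≠ i := by omega
      have h2 : x ≠ i := by omega
      simp [liftRen, hx, h1, h2]
  | _ => simp_all [LamOK, Term.rename]

/-- Under a binder the pattern variables are fixed, and all other variables receive terms shifted
past them. No occurrence of a pattern variable is gained or lost, however often the free variables
are used. -/
theorem LamOK.subst {M : Term} (h : M.LamOK) {σ : ℕ → Term} (hσ : ∀ x, (σ x).LamOK) :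
    (M.subst σ).LamOK := by
  have lift : ∀ k (σ : ℕ → Term), (∀ x, (σ x).LamOK) → ∀ x, (liftSub k σ x).LamOK := by
    intro k σ hσ x
    by_cases hx : x < k
    · simp [liftSub, hx, LamOK]
    · simpa [liftSub, hx, shift] using (hσ _).rename _
  induction M generalizing σ with
  | lam p M ih =>
    refine ⟨ih h.1 (lift _ _ hσ), fun i hi => ?_⟩
    rw [occ, wt_subst]
    refine Eq.trans ?_ (h.2 i hi)
    rw [occ]
    congr 1
    funext x
    by_cases hx : x < p.arity
    · simp [liftSub, hx, wt]
    · have h2 : x ≠ i := by omega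
      simp only [liftSub, hx, if_false, shift, wt_rename, Pi.single_apply, h2]
      convert wt_zero _
      funext y
      have : y + p.arity ≠ i := by omega
      simp [this]
  | lamBang M ih => exact ih h (lift _ _ hσ)
  | _ => simp_all [LamOK, Term.subst]

theorem LamOK.inst {k : ℕ} {M : Term} (h : M.LamOK) {N : Fin k → Term} (hN : ∀ i, (N i).LamOK) :
    (M.inst N).LamOK := by
  refine h.subst fun x => ?_
  by_cases hx : x < k <;> simp [hx, hN, LamOK]

theorem LamOK.mapQ {M : Term} (h : M.LamOK) (θ : ℕ → ℕ) : (M.mapQ θ).LamOK := by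
  induction M with
  | lam p M ih =>
    refine ⟨ih h.1, fun i hi => ?_⟩
    rw [occ, wt_mapQ]
    exact h.2 i hi
  | _ => simp_all [LamOK, Term.mapQ]

end Term
end QCalculus
end

noncomputable section
namespace QCalculus
open Term

/-! ## Well-formed terms are the terms with linear patterns and linear quantum variables -/

theorem Env.Valid.of_le {Γ Δ : Env} (h : Δ.Valid) (hle : Γ ≤ Δ) : Γ.Valid := by
  obtain ⟨Θ, rfl⟩ := Multiset.le_iff_exists_add.1 hle
  simp only [Env.Valid, Multiset.add_bind] at *
  exact ⟨(Multiset.nodup_add.1 h.1).1, (Multiset.nodup_add.1 h.2).1⟩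

theorem Env.Valid.disjoint {Γ Δ : Env} (h : (Γ + Δ).Valid) :
    Disjoint (Γ.bind EnvItem.cnames) (Δ.bind EnvItem.cnames) := by
  simp only [Env.Valid, Multiset.add_bind] at h
  exact (Multiset.nodup_add.1 h.1).2.2

theorem Env.Valid.disjoint_of_sum {n : ℕ} {Γ : Fin n → Env} (h : (∑ i, Γ i).Valid) {i j : Fin n}
    (hij : i ≠ j) : Disjoint ((Γ i).bind EnvItem.cnames) ((Γ j).bind EnvItem.cnames) := by
  refine Env.Valid.disjoint (h.of_le ?_)
  rw [← Finset.sum_pair hij]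
  exact Finset.sum_le_sum_of_subset (Finset.subset_univ _)

/-- The classical variables that an element of an environment makes available linearly. -/
def EnvItem.lnames : EnvItem → Multiset ℕ
  | .var x => {x}
  | .tup _ x => Finset.univ.val.map x
  | .bang _ => 0
  | .qvar _ => 0

theorem EnvItem.lnames_le (e : EnvItem) : e.lnames ≤ e.cnames := by
  cases e <;> simp [EnvItem.lnames, EnvItem.cnames]

theorem Env.mem_cnames_of_mem_lnames {Γ : Env} {x : ℕ} (h : x ∈ Γ.bind EnvItem.lnames) :
    x ∈ Γ.bind EnvItem.cnames := by
  simp only [Multiset.mem_bind] at *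
  obtain ⟨e, he, hx⟩ := h
  exact ⟨e, he, Multiset.mem_of_le e.lnames_le hx⟩

theorem Env.bind_sum {n : ℕ} {β : Type*} (Γ : Fin n → Env) (f : EnvItem → Multiset β) :
    (∑ i, Γ i).bind f = ∑ i, (Γ i).bind f :=
  map_sum ({ toFun := fun Γ => Γ.bind f
             map_zero' := Multiset.zero_bind f
             map_add' := fun a b => Multiset.add_bind a b f } : Env →+ Multiset β) Γ _

theorem EnvItem.cnames_shift (k : ℕ) (e : EnvItem) : (e.shift k).cnames = e.cnames.map (· + k) := by
  cases e <;> simp only [EnvItem.shift, EnvItem.cnames, Multiset.map_map, Multiset.map_singleton,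
    Multiset.map_zero, Function.comp_def]

theorem EnvItem.lnames_shift (k : ℕ) (e : EnvItem) : (e.shift k).lnames = e.lnames.map (· + k) := by
  cases e <;> simp only [EnvItem.shift, EnvItem.lnames, Multiset.map_map, Multiset.map_singleton,
    Multiset.map_zero, Function.comp_def]

theorem EnvItem.qnames_shift (k : ℕ) (e : EnvItem) : (e.shift k).qnames = e.qnames := by
  cases e <;> rfl

theorem Env.cnames_shift (k : ℕ) (Γ : Env) :
    (Γ.shift k).bind EnvItem.cnames = (Γ.bind EnvItem.cnames).map (· + k) := by
  simp [Env.shift, Multiset.bind_map, Multiset.map_bind, EnvItem.cnames_shift]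

theorem Env.lnames_shift (k : ℕ) (Γ : Env) :
    (Γ.shift k).bind EnvItem.lnames = (Γ.bind EnvItem.lnames).map (· + k) := by
  simp [Env.shift, Multiset.bind_map, Multiset.map_bind, EnvItem.lnames_shift]

theorem Env.qnames_shift (k : ℕ) (Γ : Env) :
    (Γ.shift k).bind EnvItem.qnames = Γ.bind EnvItem.qnames := by
  simp [Env.shift, Multiset.bind_map, EnvItem.qnames_shift]

theorem Env.Valid.of_shift {Γ : Env} {k : ℕ} (h : (Γ.shift k).Valid) : Γ.Valid := by
  rw [Env.Valid, Env.cnames_shift, Env.qnames_shift] at h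
  exact ⟨h.1.of_map, h.2⟩

theorem Pat.mem_lnames_item (p : Pat) {i : ℕ} (hi : i < p.arity) : i ∈ p.item.lnames := by
  cases p with
  | var => simpa [Pat.item, EnvItem.lnames, Pat.arity] using hi
  | tup n => exact Multiset.mem_map.2 ⟨(⟨i, hi⟩ : Fin (n + 2)), Finset.mem_univ _, rfl⟩

theorem Pat.lt_of_mem_cnames_item (p : Pat) {i : ℕ} (hi : i ∈ p.item.cnames) : i < p.arity := by
  cases p with
  | var => simp_all [Pat.item, EnvItem.cnames, Pat.arity]
  | tup n =>
    simp only [Pat.item, EnvItem.cnames, Multiset.mem_map] at hi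
    obtain ⟨j, -, rfl⟩ := hi
    exact j.2

theorem Term.occ_rename_ne_zero {f : ℕ → ℕ} {M : Term} {x : ℕ} (h : (M.rename f).occ x ≠ 0) :
    ∃ y, M.occ y ≠ 0 ∧ f y = x := by
  by_contra! h'
  apply h
  rw [occ, wt_rename, wt_eq_of_occ (w' := 0), wt_zero]
  intro y hy
  simp [h' y hy]

theorem Term.occ_rename_eq {f : ℕ → ℕ} {x : ℕ} (h : ∀ y, f y = x ↔ y = x) (M : Term) :
    (M.rename f).occ x = M.occ x := by
  rw [occ, wt_rename, occ]
  congr 1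
  funext y
  simp [Pi.single_apply, h]

/-- The invariant of well-formed judgements. -/
structure Sound (Γ : Env) (M : Term) : Prop where
  valid : Γ.Valid
  lamOK : M.LamOK
  occ_one : ∀ x ∈ Γ.bind EnvItem.lnames, M.occ x = 1
  occ_zero : ∀ x ∉ Γ.bind EnvItem.cnames, M.occ x = 0
  qocc_eq : ∀ r, M.qocc r = (Γ.bind EnvItem.qnames).count r

theorem Judg.sound {Γ : Env} {M : Term} (h : Judg Γ M) : Sound Γ M := by
  induction h with
  | bit | gate => constructor <;> simp [Env.Valid, LamOK, occ, qocc, wt]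
  | qvar r =>
    constructor <;> simp [Env.Valid, LamOK, occ, qocc, wt, EnvItem.cnames, EnvItem.qnames,
      EnvItem.lnames, Multiset.count_singleton, Pi.single_apply, eq_comm]
  | var x =>
    constructor <;> simp [Env.Valid, LamOK, occ, qocc, wt, EnvItem.cnames, EnvItem.qnames,
      EnvItem.lnames, Pi.single_apply, eq_comm]
  | @weak Γ M x _ hv ih =>
    refine ⟨hv, ih.lamOK, fun y hy => ih.occ_one y ?_, fun y hy => ih.occ_zero y ?_, fun r => ?_⟩
    · simpa [EnvItem.lnames] using hy
    · simp only [Multiset.add_bind, Multiset.mem_add, not_or] at hy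
      exact hy.1
    · simpa [EnvItem.qnames] using ih.qocc_eq r
  | @contr Γ M x y z _ hv ih =>
    have hx := ih.valid
    simp only [Env.Valid, Multiset.add_bind, Multiset.singleton_bind, EnvItem.cnames,
      EnvItem.qnames, add_zero, Multiset.nodup_add, Multiset.disjoint_singleton] at hx
    have hz := hv
    simp only [Env.Valid, Multiset.add_bind, Multiset.singleton_bind, EnvItem.cnames,
      EnvItem.qnames, add_zero, Multiset.nodup_add, Multiset.disjoint_singleton] at hz
    refine ⟨hv, ih.lamOK.rename _, fun u hu => ?_, fun u hu => ?_, fun r => ?_⟩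
    · simp only [Multiset.add_bind, Multiset.singleton_bind, EnvItem.lnames, add_zero] at hu
      have hu' := Env.mem_cnames_of_mem_lnames hu
      have h1 : u ≠ x := by rintro rfl; exact hx.1.1.2.2 hu'
      have h2 : u ≠ y := by
        rintro rfl; exact hx.1.2.2 (Multiset.mem_add.2 (Or.inl hu'))
      have h3 : u ≠ z := by rintro rfl; exact hz.1.2.2 hu'
      rw [occ_rename_eq]
      · exact ih.occ_one u (by simpa [EnvItem.lnames] using hu)
      · intro v
        split_ifs with hvv
        · constructor
          · rintro rfl; exact absurd rfl h3
          · rintro rfl; rcases hvv with rfl | rfl <;> contradiction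
        · rfl
    · by_contra hne
      obtain ⟨v, hv1, hv2⟩ := occ_rename_ne_zero hne
      apply hv1
      simp only [Multiset.add_bind, Multiset.singleton_bind, EnvItem.cnames, Multiset.mem_add,
        Multiset.mem_singleton, not_or] at hu
      split_ifs at hv2 with hxy
      · exact absurd hv2.symm hu.2
      · refine ih.occ_zero v ?_
        simp only [Multiset.add_bind, Multiset.singleton_bind, EnvItem.cnames, Multiset.mem_add,
          Multiset.mem_singleton]
        subst hv2
        tauto
    · rw [qocc, wt_rename]
      simpa [EnvItem.qnames, qocc] using ih.qocc_eq r
  | @prom Γ M _ hb ih =>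
    -- An environment of `!x` only has neither linear nor quantum names, so doubling the counts
    -- under `!` breaks none of the conditions.
    have hq : Γ.bind EnvItem.qnames = 0 := by
      refine Multiset.eq_zero_of_forall_notMem fun r hr => ?_
      obtain ⟨e, he, hr⟩ := Multiset.mem_bind.1 hr
      obtain ⟨x, rfl⟩ := hb e he
      simp [EnvItem.qnames] at hr
    refine ⟨ih.valid, ih.lamOK, fun y hy => ?_, fun y hy => ?_, fun r => ?_⟩
    · obtain ⟨e, he, hr⟩ := Multiset.mem_bind.1 hy
      obtain ⟨x, rfl⟩ := hb e he
      simp [EnvItem.lnames] at hr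
    · have := ih.occ_zero y hy
      simp_all [occ, wt]
    · have := ih.qocc_eq r
      simp_all [qocc, wt]
  | @der Γ M x _ ih =>
    refine ⟨?_, ih.lamOK, fun y hy => ih.occ_one y ?_, fun y hy => ih.occ_zero y ?_, fun r => ?_⟩
    · simpa [Env.Valid, EnvItem.cnames, EnvItem.qnames] using ih.valid
    · simp only [Multiset.add_bind, Multiset.singleton_bind, EnvItem.lnames, add_zero] at hy
      simp [hy]
    · simpa [EnvItem.cnames] using hy
    · simpa [EnvItem.qnames] using ih.qocc_eq r
  | @tensL Γ M n x _ ih =>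
    have hc : (Finset.univ.val.map fun i => EnvItem.var (x i)).bind EnvItem.cnames =
        Finset.univ.val.map x := by
      rw [Multiset.bind_map]
      exact Multiset.bind_singleton _ _
    have hl : (Finset.univ.val.map fun i => EnvItem.var (x i)).bind EnvItem.lnames =
        Finset.univ.val.map x := by
      rw [Multiset.bind_map]
      exact Multiset.bind_singleton _ _
    have hq : (Finset.univ.val.map fun i => EnvItem.var (x i)).bind EnvItem.qnames = 0 := by
      rw [Multiset.bind_map]
      exact Multiset.bind_zero _
    have h1 := ih.valid
    have h2 := ih.occ_one
    have h3 := ih.occ_zero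
    have h4 := ih.qocc_eq
    simp only [Env.Valid, Multiset.add_bind, hc, hl, hq] at h1 h2 h3 h4
    refine ⟨?_, ih.lamOK, ?_, ?_, ?_⟩ <;>
      simp only [Env.Valid, Multiset.add_bind, Multiset.singleton_bind, EnvItem.cnames,
        EnvItem.lnames, EnvItem.qnames] <;> assumption
  | @tensR n Γ M _ hv ih =>
    refine ⟨hv, fun i => (ih i).lamOK, fun x hx => ?_, fun x hx => ?_, fun r => ?_⟩
    · rw [Env.bind_sum, Multiset.mem_sum] at hx
      obtain ⟨i, -, hi⟩ := hx
      rw [occ, wt, Finset.sum_eq_single i]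
      · exact (ih i).occ_one x hi
      · intro j _ hj
        refine (ih j).occ_zero x fun hx => ?_
        exact Multiset.disjoint_left.1 (hv.disjoint_of_sum hj) hx (Env.mem_cnames_of_mem_lnames hi)
      · simp
    · rw [occ, wt]
      refine Finset.sum_eq_zero fun i _ => (ih i).occ_zero x fun hi => hx ?_
      rw [Env.bind_sum, Multiset.mem_sum]
      exact ⟨i, Finset.mem_univ i, hi⟩
    · rw [Env.bind_sum, Multiset.count_sum', qocc, wt]
      exact Finset.sum_congr rfl fun i _ => (ih i).qocc_eq r
  | new _ ih => exact ⟨ih.valid, ih.lamOK, ih.occ_one, ih.occ_zero, ih.qocc_eq⟩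
  | @lam Γ M p _ ih =>
    refine ⟨(ih.valid.of_le (Multiset.le_add_right _ _)).of_shift,
      ⟨ih.lamOK, fun i hi => ih.occ_one i ?_⟩, fun x hx => ?_, fun x hx => ?_, fun r => ?_⟩
    · simp [p.mem_lnames_item hi]
    · rw [occ_lam]
      refine ih.occ_one _ ?_
      rw [Multiset.add_bind, Env.lnames_shift, Multiset.mem_add]
      exact Or.inl (Multiset.mem_map_of_mem _ hx)
    · rw [occ_lam]
      refine ih.occ_zero _ ?_
      rw [Multiset.add_bind, Env.cnames_shift, Multiset.mem_add, Multiset.singleton_bind]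
      rintro (h | h)
      · exact hx (by simpa using h)
      · have := p.lt_of_mem_cnames_item h
        omega
    · have := ih.qocc_eq r
      rw [Multiset.add_bind, Env.qnames_shift, Multiset.singleton_bind] at this
      cases p <;> simpa [Pat.item, EnvItem.qnames, qocc, wt, under_zero] using this
  | @lamBang Γ M _ ih =>
    refine ⟨(ih.valid.of_le (Multiset.le_add_right _ _)).of_shift,
      ih.lamOK, fun x hx => ?_, fun x hx => ?_, fun r => ?_⟩
    · rw [occ_lamBang]
      refine ih.occ_one _ ?_
      rw [Multiset.add_bind, Env.lnames_shift, Multiset.mem_add]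
      exact Or.inl (Multiset.mem_map_of_mem _ hx)
    · rw [occ_lamBang]
      refine ih.occ_zero _ ?_
      rw [Multiset.add_bind, Env.cnames_shift, Multiset.mem_add, Multiset.singleton_bind]
      rintro (h | h)
      · exact hx (by simpa using h)
      · simp [EnvItem.cnames] at h
    · have := ih.qocc_eq r
      rw [Multiset.add_bind, Env.qnames_shift, Multiset.singleton_bind] at this
      simpa [EnvItem.qnames, qocc, wt, under_zero] using this
  | @app Γ Δ M N _ _ hv ihM ihN =>
    have hd : ∀ {x}, x ∈ Γ.bind EnvItem.cnames → x ∉ Δ.bind EnvItem.cnames :=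
      Multiset.disjoint_left.1 hv.disjoint
    refine ⟨hv, ⟨ihM.lamOK, ihN.lamOK⟩, fun x hx => ?_, fun x hx => ?_, fun r => ?_⟩
    · rw [Multiset.add_bind, Multiset.mem_add] at hx
      have hsum : (Term.app M N).occ x = M.occ x + N.occ x := rfl
      rcases hx with hx | hx
      · rw [hsum, ihM.occ_one x hx, ihN.occ_zero x (hd (Env.mem_cnames_of_mem_lnames hx))]
      · rw [hsum, ihN.occ_one x hx,
          ihM.occ_zero x fun h => hd h (Env.mem_cnames_of_mem_lnames hx)]
    · rw [Multiset.add_bind, Multiset.mem_add, not_or] at hx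
      have hsum : (Term.app M N).occ x = M.occ x + N.occ x := rfl
      rw [hsum, ihM.occ_zero x hx.1, ihN.occ_zero x hx.2]
    · rw [Multiset.add_bind, Multiset.count_add, ← ihM.qocc_eq, ← ihN.qocc_eq]
      rfl

/-! ### Derivations built from usage counts -/

/-- The variables in `T` as duplicable elements of an environment. -/
def bangEnv (T : Finset ℕ) : Env := T.val.map .bang

/-- The environment with linear variables `S`, duplicable variables `T`, quantum variables `Q`. -/
def linEnv (S T Q : Finset ℕ) : Env := S.val.map .var + Q.val.map .qvar + bangEnv T

theorem bangEnv_insert {t : ℕ} {T : Finset ℕ} (h : t ∉ T) :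
    bangEnv (insert t T) = bangEnv T + {.bang t} := by
  rw [bangEnv, Finset.insert_val_of_notMem h, Multiset.map_cons, ← Multiset.singleton_add, add_comm]
  rfl

theorem valid_linEnv {S T : Finset ℕ} (h : Disjoint S T) (Q : Finset ℕ) : (linEnv S T Q).Valid := by
  have h1 : (linEnv S T Q).bind EnvItem.cnames = S.val + T.val := by
    simp only [linEnv, bangEnv, Multiset.add_bind, Multiset.bind_map, EnvItem.cnames,
      Multiset.bind_zero, add_zero]
    exact congr_arg₂ _ ((Multiset.bind_singleton _ _).trans (Multiset.map_id _))
      ((Multiset.bind_singleton _ _).trans (Multiset.map_id _))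
  have h2 : (linEnv S T Q).bind EnvItem.qnames = Q.val := by
    simp only [linEnv, bangEnv, Multiset.add_bind, Multiset.bind_map, EnvItem.qnames,
      Multiset.bind_zero, add_zero, zero_add]
    exact (Multiset.bind_singleton _ _).trans (Multiset.map_id _)
  rw [Env.Valid, h1, h2]
  exact ⟨Multiset.nodup_add.2 ⟨S.nodup, T.nodup, Finset.disjoint_val.2 h⟩, Q.nodup⟩

theorem Judg.weak_bangEnv {Γ : Env} {M : Term} (h : Judg Γ M) (T : Finset ℕ)
    (hv : (Γ + bangEnv T).Valid) : Judg (Γ + bangEnv T) M := by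
  induction T using Finset.induction with
  | empty => simpa [bangEnv] using h
  | insert t T ht ih =>
    rw [bangEnv_insert ht, ← add_assoc] at hv ⊢
    exact .weak t (ih (hv.of_le (Multiset.le_add_right _ _))) hv

/-- The elements of `T'` are absorbed one at a time by their targets in `T`; several of them may
share a target. -/
theorem Judg.contract {Γ : Env} {T : Finset ℕ} (c : ℕ → ℕ) (T' : Finset ℕ) {M : Term}
    (hc : ∀ t ∈ T', c t ∈ T) (hd : Disjoint T' T) (h : Judg (Γ + bangEnv T + bangEnv T') M) :
    Judg (Γ + bangEnv T) (M.rename fun v => if v ∈ T' then c v else v) := by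
  induction T' using Finset.induction generalizing M with
  | empty =>
    have : (fun v : ℕ => if v ∈ (∅ : Finset ℕ) then c v else v) = id := by funext v; simp
    rw [this, rename_id]
    simpa [bangEnv] using h
  | insert t T' ht ih =>
    rw [Finset.disjoint_insert_left] at hd
    have hct := hc t (Finset.mem_insert_self t T')
    have hT : bangEnv T = bangEnv (T.erase (c t)) + {.bang (c t)} := by
      rw [← bangEnv_insert (Finset.notMem_erase _ _), Finset.insert_erase hct]
    have e1 : Γ + bangEnv T + bangEnv (insert t T') =
        (Γ + bangEnv (T.erase (c t)) + bangEnv T') + {.bang t} + {.bang (c t)} := by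
      rw [bangEnv_insert ht, hT]
      ac_rfl
    have e2 : Γ + bangEnv T + bangEnv T' =
        (Γ + bangEnv (T.erase (c t)) + bangEnv T') + {.bang (c t)} := by
      rw [hT]
      ac_rfl
    have hv : (Γ + bangEnv T + bangEnv T').Valid := by
      refine h.sound.valid.of_le ?_
      rw [bangEnv_insert ht, ← add_assoc]
      exact Multiset.le_add_right _ _
    -- The contracted variable keeps the name of the target, so the remaining contractions still
    -- find it.
    have h1 := Judg.contr t (c t) (c t) (e1 ▸ h) (e2 ▸ hv)
    rw [← e2] at h1
    have h2 := ih (fun s hs => hc s (Finset.mem_insert_of_mem hs)) hd.2 h1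
    rw [rename_rename] at h2
    convert h2 using 2
    funext v
    have hcT : c t ∉ T' := fun h => Finset.disjoint_left.1 hd.2 h hct
    have hne : c t ≠ t := by
      intro h
      rw [h] at hct
      exact hd.1 hct
    by_cases h1 : v = t
    · simp [h1, hcT]
    · by_cases h2 : v = c t
      · simp [h2, hcT, hne]
      · simp [h1, h2]

theorem sum_val_map {n : ℕ} {S : Fin n → Finset ℕ} (h : Pairwise fun i j => Disjoint (S i) (S j))
    (f : ℕ → EnvItem) : ∑ i, (S i).val.map f = (Finset.univ.biUnion S).val.map f := by
  have : (Finset.univ.biUnion S).val = ∑ i, (S i).val := by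
    rw [← Finset.disjiUnion_eq_biUnion _ _ fun i _ j _ hij => h hij]
    rfl
  rw [this]
  exact (map_sum (Multiset.mapAddMonoidHom f) _ _).symm

/-- All renamings of `M` have the judgements that the usage of their variables allows. -/
def Derivable (M : Term) : Prop :=
  ∀ (f : ℕ → ℕ) (S T : Finset ℕ), Disjoint S T → (∀ x ∈ S, (M.rename f).occ x = 1) →
    (∀ x, (M.rename f).occ x ≠ 0 → x ∈ S ∨ x ∈ T) → Judg (linEnv S T M.qvars) (M.rename f)

/-- The common core of application and tuple. The premises of these rules need disjoint
environments, while a duplicable variable may occur in several components. Each component therefore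
gets a private copy of `T`, and the copies are contracted after the rule. Making the copies is the
reason why `Derivable` speaks of all renamings. -/
theorem derivable_combine {m : ℕ} {mk : (Fin m → Term) → Term}
    (hmk : ∀ (Γ : Fin m → Env) M, (∀ i, Judg (Γ i) (M i)) → Env.Valid (∑ i, Γ i) →
      Judg (∑ i, Γ i) (mk M))
    (hren : ∀ M f, (mk M).rename f = mk fun i => (M i).rename f)
    (hwt : ∀ M v w, (mk M).wt 0 v w = ∑ i, (M i).wt 0 v w)
    (M : Fin m → Term) (hqv : (mk M).qvars = Finset.univ.biUnion fun i => (M i).qvars)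
    (hM : ∀ i, Derivable (M i)) (hq : ∀ r, (mk M).qocc r ≤ 1) : Derivable (mk M) := by
  intro f S T hST h1 h0
  set P : Fin m → Term := fun i => (M i).rename f with hP
  have hocc : ∀ x, ((mk M).rename f).occ x = ∑ i, (P i).occ x := fun x => by
    rw [hren, occ, hwt]
    rfl
  have hle : ∀ i x, (P i).occ x ≤ ∑ i, (P i).occ x := fun i x =>
    Finset.single_le_sum (f := fun i => (P i).occ x) (fun _ _ => Nat.zero_le _) (Finset.mem_univ i)
  have hle2 : ∀ i j x, i ≠ j → (P i).occ x + (P j).occ x ≤ ∑ i, (P i).occ x := fun i j x hij => by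
    rw [← Finset.sum_pair (f := fun i => (P i).occ x) hij]
    exact Finset.sum_le_sum_of_subset (Finset.subset_univ _)
  have hq2 : ∀ i j r, i ≠ j → (M i).qocc r + (M j).qocc r ≤ 1 := fun i j r hij => by
    refine le_trans ?_ (hq r)
    rw [show (mk M).qocc r = ∑ i, (M i).qocc r from hwt _ _ _,
      ← Finset.sum_pair (f := fun i => (M i).qocc r) hij]
    exact Finset.sum_le_sum_of_subset (Finset.subset_univ _)
  -- A linear variable goes to the only component in which it occurs.
  set Si : Fin m → Finset ℕ := fun i => S.filter fun x => (P i).occ x = 1 with hSi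
  have hSU : Finset.univ.biUnion Si = S := by
    ext x
    simp only [hSi, Finset.mem_biUnion, Finset.mem_univ, true_and, Finset.mem_filter]
    refine ⟨fun ⟨i, hi, _⟩ => hi, fun hx => ?_⟩
    have := h1 x hx
    rw [hocc] at this
    obtain ⟨i, -, hi⟩ : ∃ i ∈ Finset.univ, (P i).occ x ≠ 0 :=
      Finset.exists_ne_zero_of_sum_ne_zero (by omega)
    have := hle i x
    exact ⟨i, hx, by omega⟩
  have hSd : Pairwise fun i j => Disjoint (Si i) (Si j) := by
    intro i j hij
    refine Finset.disjoint_left.2 fun x hi hj => ?_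
    simp only [hSi, Finset.mem_filter] at hi hj
    have := hle2 i j x hij
    have := h1 x hi.1
    rw [hocc] at this
    omega
  have hQd : Pairwise fun i j => Disjoint (M i).qvars (M j).qvars := by
    intro i j hij
    refine Finset.disjoint_left.2 fun r hi hj => ?_
    have := hq2 i j r hij
    rw [mem_qvars] at hi hj
    omega
  obtain ⟨K, hK⟩ : ∃ K, ∀ x ∈ S ∪ T, x < K :=
    ⟨(S ∪ T).sup id + 1, fun x hx => Nat.lt_succ_of_le (Finset.le_sup (f := id) hx)⟩
  -- `K` exceeds all names in `S` and `T`, so remainders modulo `K` recover the original of a copy.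
  -- The factor is `i + 1` because a shift by `0` would leave the first copy inside `T`.
  set Ki : Fin m → ℕ := fun i => (i + 1) * K with hKi
  have hKK : ∀ i, K ≤ Ki i := fun i => Nat.le_mul_of_pos_left K (Nat.succ_pos _)
  set Ti : Fin m → Finset ℕ := fun i => T.image (· + Ki i) with hTi
  set τ : Fin m → ℕ → ℕ := fun i v => if v ∈ T then v + Ki i else v with hτ
  have hmod : ∀ i, ∀ t ∈ T, (t + Ki i) % K = t := fun i t ht => by
    rw [hKi, Nat.add_mul_mod_self_right, Nat.mod_eq_of_lt (hK t (by simp [ht]))]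
  have hJ : ∀ i, Judg (linEnv (Si i) (Ti i) (M i).qvars) ((P i).rename (τ i)) := by
    intro i
    have hdST : ∀ x ∈ Si i, x < K ∧ x ∈ S ∧ x ∉ T ∧ (P i).occ x = 1 := fun x hx => by
      simp only [hSi, Finset.mem_filter] at hx
      exact ⟨hK x (by simp [hx.1]), hx.1, Finset.disjoint_left.1 hST hx.1, hx.2⟩
    rw [rename_rename]
    refine hM i (τ i ∘ f) (Si i) (Ti i) ?_ ?_ ?_
    · refine Finset.disjoint_left.2 fun x hx hx' => ?_
      simp only [hTi, Finset.mem_image] at hx'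
      obtain ⟨t, -, rfl⟩ := hx'
      have := (hdST _ hx).1
      have := hKK i
      omega
    · intro x hx
      obtain ⟨hx1, -, hx2, hx3⟩ := hdST x hx
      rw [← rename_rename, occ_rename_eq]
      · exact hx3
      · intro y
        have := hKK i
        simp only [hτ]
        split_ifs with hy
        · constructor
          · omega
          · rintro rfl; contradiction
        · rfl
    · intro x hx
      rw [← rename_rename] at hx
      obtain ⟨y, hy, rfl⟩ := occ_rename_ne_zero hx
      have hy' := hle i y
      have hne : ((mk M).rename f).occ y ≠ 0 := by
        rw [hocc]
        have : (P i).occ y ≠ 0 := hy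
        omega
      rcases h0 y hne with hyS | hyT
      · left
        have hyT := Finset.disjoint_left.1 hST hyS
        have := h1 y hyS
        rw [hocc] at this
        have : (P i).occ y ≠ 0 := hy
        simp only [hτ, hyT, if_false, hSi, Finset.mem_filter]
        exact ⟨hyS, by omega⟩
      · right
        simp only [hτ, hyT, if_true, hTi, Finset.mem_image]
        exact ⟨y, hyT, rfl⟩
  have hTd : Pairwise fun i j => Disjoint (Ti i) (Ti j) := by
    intro i j hij
    refine Finset.disjoint_left.2 fun x hi hj => hij ?_
    simp only [hTi, Finset.mem_image] at hi hj
    obtain ⟨s, hs, rfl⟩ := hi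
    obtain ⟨t, ht, hst⟩ := hj
    have h2 : s = t := by rw [← hmod i s hs, ← hmod j t ht, hst]
    subst h2
    have hKp : 0 < K := lt_of_le_of_lt (Nat.zero_le s) (hK s (by simp [hs]))
    have h3 : ((j : ℕ) + 1) * K = (i + 1) * K := by simpa [hKi] using hst
    have := Nat.eq_of_mul_eq_mul_right hKp h3
    exact Fin.ext (by omega)
  set T' := Finset.univ.biUnion Ti with hT'
  have hT'K : ∀ x ∈ T', K ≤ x := fun x hx => by
    simp only [hT', hTi, Finset.mem_biUnion, Finset.mem_image] at hx
    obtain ⟨i, -, t, -, rfl⟩ := hx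
    have := hKK i
    omega
  have hT'T : Disjoint T' T := Finset.disjoint_left.2 fun x hx hx' => by
    have := hT'K x hx
    have := hK x (by simp [hx'])
    omega
  have hST' : Disjoint S T' := Finset.disjoint_left.2 fun x hx hx' => by
    have := hT'K x hx'
    have := hK x (by simp [hx])
    omega
  have hsum : ∑ i, linEnv (Si i) (Ti i) (M i).qvars = linEnv S T' (mk M).qvars := by
    simp only [linEnv, bangEnv, Finset.sum_add_distrib]
    rw [sum_val_map hSd, sum_val_map hQd, sum_val_map hTd, hSU, hqv]
  have hJ1 := hmk _ _ hJ (hsum ▸ valid_linEnv hST' _)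
  rw [hsum] at hJ1
  have e1 : ∀ A B : Finset ℕ, Disjoint A B → bangEnv (A ∪ B) = bangEnv A + bangEnv B :=
    fun A B hAB => by
      rw [← Finset.disjUnion_eq_union _ _ hAB, bangEnv, Finset.disjUnion_val, Multiset.map_add]
      rfl
  -- The targets of the contraction must be declared, and `T` was entirely replaced by its copies.
  have hJ2 := hJ1.weak_bangEnv T (by
    have := valid_linEnv (S := S) (T := T' ∪ T)
      (Finset.disjoint_union_right.2 ⟨hST', hST⟩) (mk M).qvars
    rwa [linEnv, e1 _ _ hT'T, ← add_assoc] at this)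
  have e2 : linEnv S T' (mk M).qvars + bangEnv T =
      (S.val.map .var + (mk M).qvars.val.map .qvar) + bangEnv T + bangEnv T' := by
    rw [linEnv]
    ac_rfl
  rw [e2] at hJ2
  have hJ3 := hJ2.contract (fun v => v % K) T' (by
    intro t ht
    simp only [hT', hTi, Finset.mem_biUnion, Finset.mem_image] at ht
    obtain ⟨i, -, t, ht, rfl⟩ := ht
    simpa only [hmod i t ht] using ht) hT'T
  rw [hren] at hJ3 ⊢
  rw [linEnv]
  convert hJ3 using 3 with i
  rw [rename_rename]
  conv_lhs => rw [← rename_id ((M i).rename f)]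
  refine rename_congr _ fun x hx => ?_
  have hx' : ((mk M).rename f).occ x ≠ 0 := by
    rw [hocc]
    have := hle i x
    have : (P i).occ x ≠ 0 := hx
    omega
  rcases h0 x hx' with hxS | hxT
  · have hxT := Finset.disjoint_left.1 hST hxS
    have hxT' := Finset.disjoint_left.1 hST' hxS
    simp [hτ, hxT, hxT']
  · have : x + Ki i ∈ T' := by
      simp only [hT', hTi, Finset.mem_biUnion, Finset.mem_image]
      exact ⟨i, Finset.mem_univ i, x, hxT, rfl⟩
    simp [hτ, hxT, this, hmod i x hxT]

theorem linEnv_shift {k : ℕ} (S T Q : Finset ℕ) :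
    (linEnv S T Q).shift k =
      linEnv (S.map (addRightEmbedding k)) (T.map (addRightEmbedding k)) Q := by
  simp [linEnv, bangEnv, Env.shift, EnvItem.shift, Function.comp_def]

theorem derivable_of_lamOK {M : Term} (h : M.LamOK) (hq : ∀ r, M.qocc r ≤ 1) : Derivable M := by
  induction M with
  | var x =>
    intro f S T hST h1 h0
    simp only [rename, occ, wt, Pi.single_apply] at *
    have hx := h0 (f x) (by simp)
    have hS : ∀ y ∈ S, y = f x := fun y hy => by
      have := h1 y hy
      by_contra hne
      simp [Ne.symm hne] at this
    have hv := valid_linEnv hST (Term.var x).qvars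
    rcases hx with hx | hx
    · have : S = {f x} := Finset.eq_singleton_iff_unique_mem.2 ⟨hx, hS⟩
      subst this
      exact (Judg.var (f x)).weak_bangEnv T hv
    · have : S = ∅ := Finset.eq_empty_of_forall_notMem fun y hy => by
        rw [hS y hy] at hy
        exact Finset.disjoint_left.1 hST hy hx
      subst this
      have hT : linEnv ∅ T (Term.var x).qvars = 0 + {.bang (f x)} + bangEnv (T.erase (f x)) := by
        conv_lhs => rw [← Finset.insert_erase hx]
        rw [linEnv, bangEnv_insert (Finset.notMem_erase _ _)]
        simp [Term.qvars, add_comm]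
      rw [hT] at hv ⊢
      exact (Judg.der (f x) (by simpa using Judg.var (f x))).weak_bangEnv _ hv
  | qvar r =>
    intro f S T hST h1 h0
    have : S = ∅ := Finset.eq_empty_of_forall_notMem fun y hy => by
      have := h1 y hy
      simp [rename, occ, wt] at this
    subst this
    exact (Judg.qvar r).weak_bangEnv T (valid_linEnv hST (Term.qvar r).qvars)
  | bit c =>
    intro f S T hST h1 h0
    have : S = ∅ := Finset.eq_empty_of_forall_notMem fun y hy => by
      have := h1 y hy
      simp [rename, occ, wt] at this
    subst this
    exact (Judg.bit c).weak_bangEnv T (valid_linEnv hST (Term.bit c).qvars)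
  | gate u =>
    intro f S T hST h1 h0
    have : S = ∅ := Finset.eq_empty_of_forall_notMem fun y hy => by
      have := h1 y hy
      simp [rename, occ, wt] at this
    subst this
    exact (Judg.gate u).weak_bangEnv T (valid_linEnv hST (Term.gate u).qvars)
  | bang M ih =>
    intro f S T hST h1 h0
    have hq2 : ∀ r, 2 * M.qocc r ≤ 1 := hq
    -- A doubled count is never `1`, so there are no linear variables; by the same parity there are
    -- no quantum variables, and the environment has the form that `prom` requires.
    have : S = ∅ := Finset.eq_empty_of_forall_notMem fun y hy => by
      have h2 : 2 * (M.rename f).occ y = 1 := h1 y hy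
      omega
    subst this
    have hQ : M.qvars = ∅ := Finset.eq_empty_of_forall_notMem fun r hr => by
      rw [mem_qvars] at hr
      have := hq2 r
      omega
    refine .prom (ih h (fun r => by have := hq2 r; omega) f ∅ T hST (by simp) fun x hx => h0 x ?_) ?_
    · have : ((Term.bang M).rename f).occ x = 2 * (M.rename f).occ x := rfl
      omega
    · intro e he
      simp only [linEnv, bangEnv, qvars, hQ] at he
      simp only [Finset.empty_val, Multiset.map_zero, zero_add, Multiset.mem_map] at he
      obtain ⟨x, -, rfl⟩ := he
      exact ⟨x, rfl⟩
  | new M ih => exact fun f S T hST h1 h0 => .new (ih h hq f S T hST h1 h0)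
  | app M N ihM ihN =>
    have hq2 : ∀ r, M.qocc r + N.qocc r ≤ 1 := hq
    refine derivable_combine (m := 2) (mk := fun P => .app (P 0) (P 1)) ?_ ?_ ?_ ![M, N] ?_ ?_ hq
    · intro Γ P hP hv
      rw [Fin.sum_univ_two] at hv ⊢
      exact .app (hP 0) (hP 1) hv
    · intro P f
      rfl
    · intro P v w
      rw [Fin.sum_univ_two]
      rfl
    · ext r
      simp [qvars]
    · intro i
      fin_cases i
      · exact ihM h.1 fun r => by have := hq2 r; omega
      · exact ihN h.2 fun r => by have := hq2 r; omega
  | tuple n M ih =>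
    refine derivable_combine (mk := Term.tuple n) (fun Γ P hP hv => .tensR hP hv)
      (fun P f => rfl) (fun P v w => rfl) M rfl (fun i => ih i (h i) fun r => ?_) hq
    refine le_trans ?_ (hq r)
    exact Finset.single_le_sum (f := fun i => (M i).qocc r) (fun _ _ => Nat.zero_le _)
      (Finset.mem_univ i)
  | lamBang M ih =>
    intro f S T hST h1 h0
    have hqM : ∀ r, M.qocc r ≤ 1 := fun r => by simpa [qocc, wt, under_zero] using hq r
    refine .lamBang ?_
    have h0T : 0 ∉ T.map (addRightEmbedding 1) := by simp
    have e : (linEnv S T (Term.lamBang M).qvars).shift 1 + {.bang 0} =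
        linEnv (S.map (addRightEmbedding 1)) (insert 0 (T.map (addRightEmbedding 1))) M.qvars := by
      rw [linEnv_shift, linEnv, linEnv, bangEnv_insert h0T, ← add_assoc]
      rfl
    rw [e]
    refine ih h hqM _ _ _ ?_ ?_ ?_
    · rw [Finset.disjoint_insert_right]
      refine ⟨by simp, (Finset.disjoint_map _).2 hST⟩
    · intro x hx
      obtain ⟨y, hy, rfl⟩ := Finset.mem_map.1 hx
      exact (occ_lamBang y _).symm.trans (h1 y hy)
    · intro x hx
      rcases Nat.eq_zero_or_pos x with rfl | hpos
      · simp
      · have hx' : ((Term.lamBang M).rename f).occ (x - 1) ≠ 0 := by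
          rw [rename, occ_lamBang, Nat.sub_add_cancel hpos]
          exact hx
        have ex : addRightEmbedding 1 (x - 1) = x := by simp; omega
        rcases h0 _ hx' with h2 | h2
        · exact Or.inl (Finset.mem_map.2 ⟨_, h2, ex⟩)
        · exact Or.inr (Finset.mem_insert_of_mem (Finset.mem_map.2 ⟨_, h2, ex⟩))
  | lam p M ih =>
    intro f S T hST h1 h0
    have hqM : ∀ r, M.qocc r ≤ 1 := fun r => by
      have := hq r
      cases p <;> simpa [qocc, wt, under_zero] using this
    refine .lam p ?_
    have hd : Disjoint (S.map (addRightEmbedding p.arity)) (Finset.range p.arity) := by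
      refine Finset.disjoint_left.2 fun x hx hx' => ?_
      obtain ⟨y, hy, rfl⟩ := Finset.mem_map.1 hx
      simp at hx'
    -- The pattern variables are first declared separately; `tensL` then gathers them when the
    -- pattern is a tuple.
    have key : Judg (Env.shift p.arity (linEnv S T M.qvars) + (Finset.range p.arity).val.map .var)
        (M.rename (liftRen p.arity f)) := by
      have e : Env.shift p.arity (linEnv S T M.qvars) + (Finset.range p.arity).val.map .var =
          linEnv ((S.map (addRightEmbedding p.arity)).disjUnion (Finset.range p.arity) hd)
            (T.map (addRightEmbedding p.arity)) M.qvars := by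
        rw [linEnv_shift, linEnv, linEnv, Finset.disjUnion_val, Multiset.map_add]
        ac_rfl
      rw [e]
      refine ih h.1 hqM _ _ _ ?_ ?_ ?_
      · rw [Finset.disjUnion_eq_union, Finset.disjoint_union_left]
        refine ⟨(Finset.disjoint_map _).2 hST, Finset.disjoint_left.2 fun x hx hx' => ?_⟩
        obtain ⟨y, hy, rfl⟩ := Finset.mem_map.1 hx'
        simp at hx
      · intro x hx
        rcases Finset.mem_disjUnion.1 hx with hx | hx
        · obtain ⟨y, hy, rfl⟩ := Finset.mem_map.1 hx
          exact (occ_lam y p _).symm.trans (h1 y hy)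
        · exact (LamOK.rename h f).2 x (Finset.mem_range.1 hx)
      · intro x hx
        rw [Finset.mem_disjUnion, Finset.mem_range]
        by_cases hxp : x < p.arity
        · exact Or.inl (Or.inr hxp)
        · have hx' : ((Term.lam p M).rename f).occ (x - p.arity) ≠ 0 := by
            rw [rename, occ_lam, Nat.sub_add_cancel (by omega)]
            exact hx
          have ex : addRightEmbedding p.arity (x - p.arity) = x := by simp; omega
          rcases h0 _ hx' with h2 | h2
          · exact Or.inl (Or.inl (Finset.mem_map.2 ⟨_, h2, ex⟩))
          · exact Or.inr (Finset.mem_map.2 ⟨_, h2, ex⟩)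
    cases p with
    | var => exact key
    | tup n =>
      refine .tensL n (fun i => (i : ℕ)) ?_
      have : (Finset.range (n + 2)).val = Finset.univ.val.map fun i : Fin (n + 2) => (i : ℕ) := by
        rw [← Nat.Iio_eq_range, ← Fin.map_valEmbedding_univ]
        rfl
      rw [Pat.arity, this, Multiset.map_map] at key
      exact key

/-- Linearity of patterns and quantum variables. -/
def Term.Good (M : Term) : Prop := M.LamOK ∧ ∀ r, M.qocc r ≤ 1

/-- This replaces environments by counts, which pass to subterms and along reductions. For the
converse, all names below a bound on the free variables are declared duplicable, so nothing is asked
of how often they occur. -/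
theorem exists_judg_iff {M : Term} : (∃ Γ, Judg Γ M) ↔ M.Good := by
  constructor
  · rintro ⟨Γ, h⟩
    refine ⟨h.sound.lamOK, fun r => ?_⟩
    rw [h.sound.qocc_eq]
    exact Multiset.nodup_iff_count_le_one.1 h.sound.valid.2 r
  · rintro ⟨h, hq⟩
    obtain ⟨K, hK⟩ : ∃ K, ∀ x, M.occ x ≠ 0 → x < K := by
      clear h hq
      induction M with
      | var x =>
        refine ⟨x + 1, fun y hy => ?_⟩
        by_contra hlt
        have : x ≠ y := by omega
        simp [occ, wt, this] at hy
      | qvar | bit | gate => exact ⟨0, fun x hx => absurd rfl hx⟩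
      | bang M ih | new M ih =>
        obtain ⟨K, hK⟩ := ih
        exact ⟨K, fun x hx => hK x (by simpa [occ, wt] using hx)⟩
      | app M N ihM ihN =>
        obtain ⟨K, hK⟩ := ihM
        obtain ⟨L, hL⟩ := ihN
        refine ⟨K + L, fun x hx => ?_⟩
        have hx' : M.occ x + N.occ x ≠ 0 := hx
        rcases Nat.eq_zero_or_pos (M.occ x) with h0 | h0
        · have := hL x (by omega)
          omega
        · have := hK x (by omega)
          omega
      | tuple n M ih =>
        choose K hK using ih
        refine ⟨Finset.univ.sup K, fun x hx => ?_⟩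
        have hx' : ∑ i, (M i).occ x ≠ 0 := hx
        obtain ⟨i, hi, hne⟩ := Finset.exists_ne_zero_of_sum_ne_zero hx'
        exact lt_of_lt_of_le (hK i x hne) (Finset.le_sup hi)
      | lamBang M ih =>
        obtain ⟨K, hK⟩ := ih
        refine ⟨K, fun x hx => ?_⟩
        have := hK (x + 1) (by rwa [← occ_lamBang])
        omega
      | lam p M ih =>
        obtain ⟨K, hK⟩ := ih
        refine ⟨K, fun x hx => ?_⟩
        have := hK (x + p.arity) (by rwa [← occ_lam])
        omega
    have := derivable_of_lamOK h hq id ∅ (Finset.range K) (by simp) (by simp)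
    rw [rename_id] at this
    exact ⟨_, this fun x hx => Or.inr (Finset.mem_range.2 (hK x hx))⟩

theorem PreConfig.ok_iff {c : PreConfig} : c.Ok ↔ c.term.qvars ⊆ c.qv ∧ c.term.Good := by
  rw [PreConfig.Ok, exists_judg_iff]

end QCalculus
end

noncomputable section
namespace QCalculus
open Term

/-! ## Reduction of terms -/

/-- The effect of a reduction on the quantum register. -/
inductive Act : Type
  | id : Act
  | gate (u k : ℕ) (r : Fin (k + 1) → ℕ) : Act
  | new (c : Bool) (r : ℕ) : Act

/-- The reduction rules on terms, without their closure under contexts. -/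
inductive Root : Label → Act → Term → Term → Prop
  | Uq (u k : ℕ) (r : Fin (k + 1) → ℕ) :
      Root .Uq (.gate u k r) (.app (.gate u) (.qtuple k r)) (.qtuple k r)
  | new (c : Bool) (r : ℕ) : Root .new (.new c r) (.new (.bit c)) (.qvar r)
  | lbeta (M N : Term) : Root .lbeta .id (.app (.lam .var M) N) (M.inst (k := 1) fun _ => N)
  | qbeta (n : ℕ) (M : Term) (r : Fin (n + 2) → ℕ) :
      Root .qbeta .id (.app (.lam (.tup n) M) (.tuple n fun i => .qvar (r i)))
        (M.inst fun i => .qvar (r i))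
  | cbeta (M N : Term) :
      Root .cbeta .id (.app (.lamBang M) (.bang N)) (M.inst (k := 1) fun _ => N)
  | lcm (p : Pat) (L M N : Term) :
      Root .lcm .id (.app L (.app (.lam p M) N)) (.app (.lam p (.app (L.shift p.arity) M)) N)
  | rcm (p : Pat) (L M N : Term) :
      Root .rcm .id (.app (.app (.lam p M) N) L) (.app (.lam p (.app M (L.shift p.arity))) N)

/-- The closure of a relation under all contexts but `!`. -/
inductive Ctx (R : Term → Term → Prop) : Term → Term → Prop
  | root {M M' : Term} : R M M' → Ctx R M M'
  | inTuple {n : ℕ} {M : Fin (n + 2) → Term} {M' : Term} (i : Fin (n + 2)) :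
      Ctx R (M i) M' → Ctx R (.tuple n M) (.tuple n (Function.update M i M'))
  | appL {M M' N : Term} : Ctx R M M' → Ctx R (.app M N) (.app M' N)
  | appR {M N N' : Term} : Ctx R N N' → Ctx R (.app M N) (.app M N')
  | inNew {M M' : Term} : Ctx R M M' → Ctx R (.new M) (.new M')
  | inLam {p : Pat} {M M' : Term} : Ctx R M M' → Ctx R (.lam p M) (.lam p M')
  | inLamBang {M M' : Term} : Ctx R M M' → Ctx R (.lamBang M) (.lamBang M')

/-- The classical labels. -/
def classicalLabels : Set Label := {.lbeta, .cbeta, .lcm, .rcm}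

/-- The rules with labels in `S`, with the given effect. -/
def RootIn (S : Set Label) (a : Act) (M M' : Term) : Prop := ∃ α ∈ S, Root α a M M'

theorem Ctx.mono {R R' : Term → Term → Prop} (h : ∀ M M', R M M' → R' M M') {M M' : Term}
    (hM : Ctx R M M') : Ctx R' M M' := by
  induction hM with
  | root hr => exact .root (h _ _ hr)
  | inTuple i _ ih => exact .inTuple i ih
  | appL _ ih => exact .appL ih
  | appR _ ih => exact .appR ih
  | inNew _ ih => exact .inNew ih
  | inLam _ ih => exact .inLam ih
  | inLamBang _ ih => exact .inLamBang ih

theorem ctx_rootIn_iff {S : Set Label} {a : Act} {M M' : Term} :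
    Ctx (RootIn S a) M M' ↔ ∃ α ∈ S, Ctx (Root α a) M M' := by
  constructor
  · intro h
    induction h with
    | root hr => obtain ⟨α, hα, hr⟩ := hr; exact ⟨α, hα, .root hr⟩
    | inTuple i _ ih => obtain ⟨α, hα, hr⟩ := ih; exact ⟨α, hα, .inTuple i hr⟩
    | appL _ ih => obtain ⟨α, hα, hr⟩ := ih; exact ⟨α, hα, .appL hr⟩
    | appR _ ih => obtain ⟨α, hα, hr⟩ := ih; exact ⟨α, hα, .appR hr⟩
    | inNew _ ih => obtain ⟨α, hα, hr⟩ := ih; exact ⟨α, hα, .inNew hr⟩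
    | inLam _ ih => obtain ⟨α, hα, hr⟩ := ih; exact ⟨α, hα, .inLam hr⟩
    | inLamBang _ ih => obtain ⟨α, hα, hr⟩ := ih; exact ⟨α, hα, .inLamBang hr⟩
  · rintro ⟨α, hα, h⟩
    exact h.mono fun M M' hr => ⟨α, hα, hr⟩

/-! ### Stability under substitution -/

theorem Root.subst {α : Label} {a : Act} {M M' : Term} (h : Root α a M M') (σ : ℕ → Term) :
    Root α a (M.subst σ) (M'.subst σ) := by
  cases h with
  | Uq u k r => simpa only [Term.subst, qtuple_subst] using Root.Uq u k r
  | new c r => exact .new c r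
  | lbeta M N => rw [inst_subst]; exact .lbeta _ _
  | qbeta n M r => rw [inst_subst]; exact .qbeta n _ r
  | cbeta M N => rw [inst_subst]; exact .cbeta _ _
  | lcm p L M N => simp only [Term.subst, shift_subst]; exact .lcm p _ _ _
  | rcm p L M N => simp only [Term.subst, shift_subst]; exact .rcm p _ _ _

/-- Stability of a relation under substitution. -/
def SubstStable (R : Term → Term → Prop) : Prop :=
  ∀ ⦃M M'⦄, R M M' → ∀ σ, R (M.subst σ) (M'.subst σ)

theorem RootIn.substStable (S : Set Label) (a : Act) : SubstStable (RootIn S a) :=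
  fun _ _ ⟨α, hα, h⟩ σ => ⟨α, hα, h.subst σ⟩

theorem Ctx.subst {R : Term → Term → Prop} (hR : SubstStable R) {M M' : Term} (h : Ctx R M M')
    (σ : ℕ → Term) : Ctx R (M.subst σ) (M'.subst σ) := by
  induction h generalizing σ with
  | root hr => exact .root (hR hr σ)
  | @inTuple n M M' i _ ih =>
    have : (Term.tuple n (Function.update M i M')).subst σ =
        .tuple n (Function.update (fun j => (M j).subst σ) i (M'.subst σ)) := by
      simp only [Term.subst]
      congr 1
      funext j
      exact Function.apply_update (fun _ P => Term.subst σ P) M i M' j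
    rw [this]
    exact .inTuple i (ih σ)
  | appL _ ih => exact .appL (ih σ)
  | appR _ ih => exact .appR (ih σ)
  | inNew _ ih => exact .inNew (ih σ)
  | inLam _ ih => exact .inLam (ih _)
  | inLamBang _ ih => exact .inLamBang (ih _)

theorem Ctx.shift {R : Term → Term → Prop} (hR : SubstStable R) {M M' : Term} (h : Ctx R M M')
    (k : ℕ) : Ctx R (M.shift k) (M'.shift k) := by
  rw [Term.shift, Term.shift, ← subst_var_comp, ← subst_var_comp]
  exact h.subst hR _

theorem Ctx.liftSub {R : Term → Term → Prop} (hR : SubstStable R) {σ τ : ℕ → Term} {x : ℕ}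
    (h : Ctx R (σ x) (τ x)) (k : ℕ) : Ctx R (liftSub k σ (x + k)) (liftSub k τ (x + k)) := by
  simpa [Term.liftSub] using h.shift hR k

theorem liftSub_congr {σ τ : ℕ → Term} {x : ℕ} (h : ∀ y, y ≠ x → σ y = τ y) (k : ℕ) {y : ℕ}
    (hy : y ≠ x + k) : liftSub k σ y = liftSub k τ y := by
  by_cases hk : y < k
  · simp [liftSub, hk]
  · simp only [liftSub, hk, if_false]
    rw [h _ (by omega)]

/-- A reduction in a term substituted for a linear variable. -/
theorem Ctx.subst_linear {R : Term → Term → Prop} (hR : SubstStable R) {σ τ : ℕ → Term} {x : ℕ}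
    (h : Ctx R (σ x) (τ x)) (hne : ∀ y, y ≠ x → σ y = τ y) {M : Term} (hM : M.occ x = 1) :
    Ctx R (M.subst σ) (M.subst τ) := by
  have cong : ∀ {M : Term}, M.occ x = 0 → M.subst σ = M.subst τ := fun {M} hM =>
    subst_congr M fun y hy => hne y fun hyx => hy (hyx ▸ hM)
  induction M generalizing σ τ x with
  | var y =>
    have : y = x := by
      by_contra hyx
      simp [occ, wt, hyx] at hM
    exact this ▸ h
  | qvar | bit | gate => simp [occ, wt] at hM
  -- The doubled count excludes an occurrence under `!`, where the reduction would be forbidden.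
  | bang M ih =>
    have : 2 * M.occ x = 1 := hM
    omega
  | new M ih => exact .inNew (ih h hne hM cong)
  | app M N ihM ihN =>
    have hs : M.occ x + N.occ x = 1 := hM
    simp only [Term.subst]
    rcases Nat.eq_zero_or_pos (M.occ x) with h0 | h0
    · rw [cong h0]
      exact .appR (ihN h hne (by omega) cong)
    · rw [cong (M := N) (by omega)]
      exact .appL (ihM h hne (by omega) cong)
  | tuple n M ih =>
    have hs : ∑ i, (M i).occ x = 1 := hM
    obtain ⟨i, -, hi⟩ : ∃ i ∈ Finset.univ, (M i).occ x ≠ 0 :=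
      Finset.exists_ne_zero_of_sum_ne_zero (by omega)
    have hsum := Finset.add_sum_erase Finset.univ (fun i => (M i).occ x) (Finset.mem_univ i)
    simp only [hs] at hsum
    have hz : ∀ j, j ≠ i → (M j).occ x = 0 := fun j hj => by
      have h1 : ∑ i ∈ Finset.univ.erase i, (M i).occ x = 0 := by omega
      exact Finset.sum_eq_zero_iff.1 h1 j (by simp [hj])
    have : (Term.tuple n M).subst τ = .tuple n (Function.update (fun j => (M j).subst σ) i
        ((M i).subst τ)) := by
      simp only [Term.subst]
      congr 1
      funext j
      by_cases hj : j = i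
      · subst hj; simp
      · simp [hj, cong (hz j hj)]
    rw [this]
    exact .inTuple i (ih i h hne (by omega) cong)
  | lamBang M ih =>
    rw [occ_lamBang] at hM
    have hl := fun y => liftSub_congr (y := y) hne 1
    exact .inLamBang (ih (h.liftSub hR 1) hl hM fun {M} hM =>
      subst_congr M fun y hy => hl y fun hyx => hy (hyx ▸ hM))
  | lam p M ih =>
    rw [occ_lam] at hM
    have hl := fun y => liftSub_congr (y := y) hne p.arity
    exact .inLam (ih (h.liftSub hR p.arity) hl hM fun {M} hM =>
      subst_congr M fun y hy => hl y fun hyx => hy (hyx ▸ hM))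

/-! ### Reflection by substitutions of quantum variables -/

/-- A substitution of variables and quantum variables for the classical variables. -/
def Rigid (σ : ℕ → Term) : Prop := ∀ x, (∃ y, σ x = .var y) ∨ ∃ r, σ x = .qvar r

theorem Rigid.liftSub {σ : ℕ → Term} (h : Rigid σ) (k : ℕ) : Rigid (liftSub k σ) := by
  intro x
  by_cases hx : x < k
  · simp [Term.liftSub, hx]
  · rcases h (x - k) with ⟨y, hy⟩ | ⟨r, hr⟩
    · simp [Term.liftSub, hx, hy, Term.shift, rename]
    · simp [Term.liftSub, hx, hr, Term.shift, rename]

theorem rigid_qvars {k : ℕ} (r : Fin k → ℕ) :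
    Rigid fun x => if h : x < k then Term.qvar (r ⟨x, h⟩) else .var (x - k) := by
  intro x
  by_cases hx : x < k <;> simp [hx]

theorem Rigid.app_inv {σ : ℕ → Term} (h : Rigid σ) {P A B : Term} (hP : P.subst σ = .app A B) :
    ∃ A' B', P = .app A' B' ∧ A'.subst σ = A ∧ B'.subst σ = B := by
  cases P <;> simp only [Term.subst, reduceCtorEq, Term.app.injEq] at hP
  case var x => rcases h x with ⟨y, hy⟩ | ⟨r, hr⟩ <;> simp_all
  case app A' B' => exact ⟨A', B', rfl, hP⟩

theorem Rigid.lam_inv {σ : ℕ → Term} (h : Rigid σ) {P A : Term} {p : Pat}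
    (hP : P.subst σ = .lam p A) : ∃ A', P = .lam p A' ∧ A'.subst (Term.liftSub p.arity σ) = A := by
  cases P <;> simp only [Term.subst, reduceCtorEq, Term.lam.injEq] at hP
  case var x => rcases h x with ⟨y, hy⟩ | ⟨r, hr⟩ <;> simp_all
  case lam q A' => obtain ⟨rfl, rfl⟩ := hP; exact ⟨A', rfl, rfl⟩

theorem Rigid.lamBang_inv {σ : ℕ → Term} (h : Rigid σ) {P A : Term}
    (hP : P.subst σ = .lamBang A) : ∃ A', P = .lamBang A' ∧ A'.subst (Term.liftSub 1 σ) = A := by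
  cases P <;> simp only [Term.subst, reduceCtorEq, Term.lamBang.injEq] at hP
  case var x => rcases h x with ⟨y, hy⟩ | ⟨r, hr⟩ <;> simp_all
  case lamBang A' => exact ⟨A', rfl, hP⟩

theorem Rigid.bang_inv {σ : ℕ → Term} (h : Rigid σ) {P A : Term}
    (hP : P.subst σ = .bang A) : ∃ A', P = .bang A' ∧ A'.subst σ = A := by
  cases P <;> simp only [Term.subst, reduceCtorEq, Term.bang.injEq] at hP
  case var x => rcases h x with ⟨y, hy⟩ | ⟨r, hr⟩ <;> simp_all
  case bang A' => exact ⟨A', rfl, hP⟩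

theorem Rigid.new_inv {σ : ℕ → Term} (h : Rigid σ) {P A : Term}
    (hP : P.subst σ = .new A) : ∃ A', P = .new A' ∧ A'.subst σ = A := by
  cases P <;> simp only [Term.subst, reduceCtorEq, Term.new.injEq] at hP
  case var x => rcases h x with ⟨y, hy⟩ | ⟨r, hr⟩ <;> simp_all
  case new A' => exact ⟨A', rfl, hP⟩

theorem Rigid.bit_inv {σ : ℕ → Term} (h : Rigid σ) {P : Term} {c : Bool}
    (hP : P.subst σ = .bit c) : P = .bit c := by
  cases P <;> simp only [Term.subst, reduceCtorEq, Term.bit.injEq] at hP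
  case var x => rcases h x with ⟨y, hy⟩ | ⟨r, hr⟩ <;> simp_all
  case bit A' => rw [hP]

theorem Rigid.tuple_inv {σ : ℕ → Term} (h : Rigid σ) {P : Term} {n : ℕ} {A : Fin (n + 2) → Term}
    (hP : P.subst σ = .tuple n A) : ∃ A', P = .tuple n A' ∧ ∀ i, (A' i).subst σ = A i := by
  cases P <;> simp only [Term.subst, reduceCtorEq, Term.tuple.injEq] at hP
  case var x => rcases h x with ⟨y, hy⟩ | ⟨r, hr⟩ <;> simp_all
  case tuple m A' =>
    obtain ⟨rfl, hA⟩ := hP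
    exact ⟨A', rfl, fun i => congr_fun (eq_of_heq hA) i⟩

/-- These redexes are recognised from abstractions, applications, bangs and bits, none of which a
variable or a quantum variable supplies. The quantum rules must be excluded: a tuple of variables
can become a tuple of quantum variables. -/
theorem Root.reflect {α : Label} {a : Act} (hα : α ∉ quantumLabels) {σ : ℕ → Term} (hσ : Rigid σ)
    {P M : Term} (h : Root α a (P.subst σ) M) : ∃ P', Root α a P P' ∧ P'.subst σ = M := by
  generalize hQ : P.subst σ = Q at h
  cases h with
  | Uq | qbeta => simp [quantumLabels] at hα
  | new c r =>
    obtain ⟨A, rfl, hA⟩ := hσ.new_inv hQ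
    rw [hσ.bit_inv hA]
    exact ⟨_, .new c r, rfl⟩
  | lbeta A B =>
    obtain ⟨A', B', rfl, hA, rfl⟩ := hσ.app_inv hQ
    obtain ⟨A', rfl, rfl⟩ := hσ.lam_inv hA
    exact ⟨_, .lbeta A' B', inst_subst _ _ _⟩
  | cbeta A B =>
    obtain ⟨A', B', rfl, hA, hB⟩ := hσ.app_inv hQ
    obtain ⟨A', rfl, rfl⟩ := hσ.lamBang_inv hA
    obtain ⟨B', rfl, rfl⟩ := hσ.bang_inv hB
    exact ⟨_, .cbeta A' B', inst_subst _ _ _⟩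
  | lcm p L A B =>
    obtain ⟨L', B', rfl, rfl, hB⟩ := hσ.app_inv hQ
    obtain ⟨A', B', rfl, hA, rfl⟩ := hσ.app_inv hB
    obtain ⟨A', rfl, rfl⟩ := hσ.lam_inv hA
    exact ⟨_, .lcm p L' A' B', by simp only [Term.subst, shift_subst]⟩
  | rcm p L A B =>
    obtain ⟨B', L', rfl, hB, rfl⟩ := hσ.app_inv hQ
    obtain ⟨A', B', rfl, hA, rfl⟩ := hσ.app_inv hB
    obtain ⟨A', rfl, rfl⟩ := hσ.lam_inv hA
    exact ⟨_, .rcm p L' A' B', by simp only [Term.subst, shift_subst]⟩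

theorem Ctx.reflect {α : Label} {a : Act} (hα : α ∉ quantumLabels) {σ : ℕ → Term} (hσ : Rigid σ)
    {P M : Term} (h : Ctx (Root α a) (P.subst σ) M) :
    ∃ P', Ctx (Root α a) P P' ∧ P'.subst σ = M := by
  generalize hQ : P.subst σ = Q at h
  induction h generalizing P σ with
  | root hr =>
    subst hQ
    obtain ⟨P', h1, h2⟩ := hr.reflect hα hσ
    exact ⟨P', .root h1, h2⟩
  | @inTuple n A A' i _ ih =>
    obtain ⟨B, rfl, hB⟩ := hσ.tuple_inv hQ
    obtain ⟨P', h1, rfl⟩ := ih hσ (hB i)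
    refine ⟨_, .inTuple i h1, ?_⟩
    simp only [Term.subst]
    congr 1
    funext j
    rw [Function.apply_update (fun _ P => Term.subst σ P)]
    congr 1
    funext j
    exact hB j
  | appL _ ih =>
    obtain ⟨A, B, rfl, hA, rfl⟩ := hσ.app_inv hQ
    obtain ⟨P', h1, rfl⟩ := ih hσ hA
    exact ⟨_, .appL h1, rfl⟩
  | appR _ ih =>
    obtain ⟨A, B, rfl, rfl, hA⟩ := hσ.app_inv hQ
    obtain ⟨P', h1, rfl⟩ := ih hσ hA
    exact ⟨_, .appR h1, rfl⟩
  | inNew _ ih =>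
    obtain ⟨A, rfl, hA⟩ := hσ.new_inv hQ
    obtain ⟨P', h1, rfl⟩ := ih hσ hA
    exact ⟨_, .inNew h1, rfl⟩
  | inLam _ ih =>
    obtain ⟨A, rfl, hA⟩ := hσ.lam_inv hQ
    obtain ⟨P', h1, rfl⟩ := ih (hσ.liftSub _) hA
    exact ⟨_, .inLam h1, rfl⟩
  | inLamBang _ ih =>
    obtain ⟨A, rfl, hA⟩ := hσ.lamBang_inv hQ
    obtain ⟨P', h1, rfl⟩ := ih (hσ.liftSub _) hA
    exact ⟨_, .inLamBang h1, rfl⟩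

end QCalculus
end

noncomputable section
namespace QCalculus
open Term Relation

/-! ### Weights along reductions, subject reduction -/

/-- The weight of the quantum variables created by a reduction. -/
def Act.wt (v : ℕ → ℕ) : Act → ℕ
  | .new _ r => v r
  | _ => 0

/-- The weight lost in a reduction where gates and abstractions over tuples weigh `a`. -/
def Label.drop (a : ℕ) : Label → ℕ
  | .Uq => a
  | .qbeta => a
  | _ => 0

/-- A weight is a sum over subterms, and the one multiplier, at `!`, is on no path to a redex, so
the change at the redex is the change of the whole term. The loss `e` and the gain `d` stand on
opposite sides to avoid truncated subtraction. The bound `N` is inherited by the redex, whose weight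
is at most that of the term. -/
theorem Ctx.wt_eq {R : Term → Term → Prop} {a N d e : ℕ} {v : ℕ → ℕ}
    (hR : ∀ M M' w, R M M' → M.LamOK → M.wt a v w ≤ N → M'.wt a v w + e = M.wt a v w + d)
    {M M' : Term} (h : Ctx R M M') (hM : M.LamOK) (w : ℕ → ℕ) (hN : M.wt a v w ≤ N) :
    M'.wt a v w + e = M.wt a v w + d := by
  induction h generalizing w with
  | root hr => exact hR _ _ w hr hM hN
  | @inTuple n M M' i _ ih =>
    simp only [Term.wt] at *
    have h1 := Finset.add_sum_erase Finset.univ (fun j => (M j).wt a v w) (Finset.mem_univ i)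
    have h2 := Finset.add_sum_erase Finset.univ (fun j => (Function.update M i M' j).wt a v w)
      (Finset.mem_univ i)
    have h3 : ∑ j ∈ Finset.univ.erase i, (Function.update M i M' j).wt a v w =
        ∑ j ∈ Finset.univ.erase i, (M j).wt a v w :=
      Finset.sum_congr rfl fun j hj => by rw [Function.update_of_ne (Finset.ne_of_mem_erase hj)]
    have h4 := ih (hM i) w (by omega)
    simp only [Function.update_self] at h2
    omega
  | appL _ ih =>
    simp only [Term.wt] at *
    have := ih hM.1 w (by omega)
    omega
  | appR _ ih =>
    simp only [Term.wt] at *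
    have := ih hM.2 w (by omega)
    omega
  | inNew _ ih => exact ih hM w hN
  | @inLam p _ _ _ ih =>
    cases p <;> simp only [Term.wt] at *
    · exact ih hM.1 _ hN
    · have := ih hM.1 _ (le_trans (Nat.le_add_left _ _) hN)
      omega
  | inLamBang _ ih => exact ih hM _ hN

/-- Linear patterns copy and erase nothing. `cbeta` may do so, but its argument is under `!` and
counts twice, so a total weight of at most `1` leaves it weight `0`. -/
theorem Root.wt_eq {α : Label} {b : Act} {M M' : Term} (h : Root α b M M') (hM : M.LamOK)
    (a : ℕ) (v w : ℕ → ℕ) (ha : α = .cbeta ∨ α = .new → a = 0 ∧ M.wt a v w ≤ 1) :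
    M'.wt a v w + α.drop a = M.wt a v w + b.wt v := by
  cases h with
  | Uq u k r => simp [Term.wt, wt_qtuple, Act.wt, Label.drop, add_comm]
  | new c r =>
    obtain ⟨rfl, -⟩ := ha (Or.inr rfl)
    simp [Term.wt, Act.wt, Label.drop]
  | lbeta M N =>
    have := hM.1.2 0 (by simp [Pat.arity])
    simp [wt_inst, Term.wt, Act.wt, Label.drop, this]
  | qbeta n M r =>
    have : ∀ i : Fin (n + 2), M.occ i = 1 := fun i => hM.1.2 i i.2
    simp only [wt_inst, Term.wt, Act.wt, Label.drop, this]
    simp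
    ring
  | cbeta M N =>
    obtain ⟨rfl, h1⟩ := ha (Or.inl rfl)
    simp only [Term.wt] at h1
    have h0 : N.wt 0 v w = 0 := by omega
    simp [wt_inst, Term.wt, Act.wt, Label.drop, h0]
  | lcm p L M N => cases p <;> simp [Term.wt, wt_shift, Act.wt, Label.drop, Pat.arity] <;> ring
  | rcm p L M N => cases p <;> simp [Term.wt, wt_shift, Act.wt, Label.drop, Pat.arity] <;> ring

theorem Ctx.wt_root {α : Label} {b : Act} {M M' : Term} (h : Ctx (Root α b) M M') (hM : M.LamOK)
    (v w : ℕ → ℕ) (h1 : M.wt 0 v w ≤ 1) : M'.wt 0 v w = M.wt 0 v w + b.wt v := by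
  refine h.wt_eq (e := 0) (fun M M' w hr hM h1 => ?_) hM w h1
  have hd : α.drop 0 = 0 := by cases α <;> rfl
  simpa only [hd] using hr.wt_eq hM 0 v w fun _ => ⟨rfl, h1⟩

theorem Term.occ_shift {i k : ℕ} (hi : i < k) (M : Term) : (M.shift k).occ i = 0 := by
  by_contra h
  obtain ⟨y, -, hy⟩ := occ_rename_ne_zero h
  omega

theorem Root.lamOK {α : Label} {b : Act} {M M' : Term} (h : Root α b M M') (hM : M.LamOK) :
    M'.LamOK := by
  cases h with
  | Uq u k r => exact hM.2
  | new c r => trivial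
  | lbeta M N => exact hM.1.1.inst fun _ => hM.2
  | qbeta n M r => exact hM.1.1.inst fun _ => trivial
  | cbeta M N =>
    have h1 : M.LamOK := hM.1
    exact h1.inst fun _ => hM.2
  | lcm p L M N =>
    refine ⟨⟨⟨hM.1.rename _, hM.2.1.1⟩, fun i hi => ?_⟩, hM.2.2⟩
    have : (Term.app (L.shift p.arity) M).occ i = (L.shift p.arity).occ i + M.occ i := rfl
    rw [this, occ_shift hi, hM.2.1.2 i hi]
  | rcm p L M N =>
    refine ⟨⟨⟨hM.1.1.1, hM.2.rename _⟩, fun i hi => ?_⟩, hM.1.2⟩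
    have : (Term.app M (L.shift p.arity)).occ i = M.occ i + (L.shift p.arity).occ i := rfl
    rw [this, occ_shift hi, hM.1.1.2 i hi]

theorem Ctx.lamOK {α : Label} {b : Act} {M M' : Term} (h : Ctx (Root α b) M M') (hM : M.LamOK) :
    M'.LamOK := by
  induction h with
  | root hr => exact hr.lamOK hM
  | @inTuple n M M' i _ ih =>
    intro j
    by_cases hj : j = i
    · subst hj
      simpa using ih (hM j)
    · simpa [hj] using hM j
  | appL _ ih => exact ⟨ih hM.1, hM.2⟩
  | appR _ ih => exact ⟨hM.1, ih hM.2⟩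
  | inNew _ ih => exact ih hM
  | inLam h ih =>
    refine ⟨ih hM.1, fun i hi => ?_⟩
    have h1 := hM.2 i hi
    rw [occ] at h1 ⊢
    -- The count of a pattern variable is a weight equal to `1`, within the range where even `cbeta`
    -- preserves it.
    rw [h.wt_root hM.1 _ _ h1.le, h1]
    cases b <;> rfl
  | inLamBang _ ih => exact ih hM

theorem Ctx.qocc {α : Label} {b : Act} {M M' : Term} (h : Ctx (Root α b) M M') (hM : M.Good)
    (s : ℕ) : M'.qocc s = M.qocc s + b.wt (Pi.single s 1) :=
  h.wt_root hM.1 _ _ (hM.2 s)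

/-! ### Classical reductions can be performed first -/

/-- Classical reduction of terms. -/
def Classical : Term → Term → Prop := Ctx (RootIn classicalLabels .id)

/-- Non classical reduction of terms. -/
def NonClassical (a : Act) : Term → Term → Prop := Ctx (RootIn nonClassicalLabels a)

theorem qtuple_normal {α : Label} {a : Act} {k : ℕ} {r : Fin (k + 1) → ℕ} {M : Term} :
    ¬ Ctx (Root α a) (qtuple k r) M := by
  intro h
  cases k with
  | zero => cases h with | root hr => cases hr
  | succ k =>
    cases h with
    | root hr => cases hr
    | inTuple i h => cases h with | root hr => cases hr

/-- Reduction of a `qbeta` redex. -/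
def QRedex (a : Act) (M M' : Term) : Prop :=
  ∃ (n : ℕ) (P : Term) (r : Fin (n + 2) → ℕ), a = .id ∧
    M = .app (.lam (.tup n) P) (.tuple n fun i => .qvar (r i)) ∧ M' = P.inst fun i => .qvar (r i)

/-- Only `qbeta` can have an abstraction, an application or a bang as its result; the inversions
that follow all come from this. -/
theorem nonClassical_root {a : Act} {M M' : Term} (h : RootIn nonClassicalLabels a M M') :
    QRedex a M M' ∨ ∃ k r, M' = qtuple k r := by
  obtain ⟨α, hα, h⟩ := h
  cases h with
  | Uq u k r => exact Or.inr ⟨k, r, rfl⟩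
  | new c r => exact Or.inr ⟨0, fun _ => r, rfl⟩
  | qbeta n M r => exact Or.inl ⟨n, M, r, rfl, rfl, rfl⟩
  | _ => simp [nonClassicalLabels, quantumLabels] at hα

theorem nonClassical_lam {a : Act} {M P : Term} {p : Pat} (h : NonClassical a M (.lam p P)) :
    QRedex a M (.lam p P) ∨ ∃ P', M = .lam p P' ∧ NonClassical a P' P := by
  cases h with
  | root hr =>
    rcases nonClassical_root hr with h | ⟨k, r, h⟩
    · exact Or.inl h
    · cases k <;> simp [qtuple] at h
  | inLam h => exact Or.inr ⟨_, rfl, h⟩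

theorem nonClassical_lamBang {a : Act} {M P : Term} (h : NonClassical a M (.lamBang P)) :
    QRedex a M (.lamBang P) ∨ ∃ P', M = .lamBang P' ∧ NonClassical a P' P := by
  cases h with
  | root hr =>
    rcases nonClassical_root hr with h | ⟨k, r, h⟩
    · exact Or.inl h
    · cases k <;> simp [qtuple] at h
  | inLamBang h => exact Or.inr ⟨_, rfl, h⟩

theorem nonClassical_bang {a : Act} {M P : Term} (h : NonClassical a M (.bang P)) :
    QRedex a M (.bang P) := by
  cases h with
  | root hr =>
    rcases nonClassical_root hr with h | ⟨k, r, h⟩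
    · exact h
    · cases k <;> simp [qtuple] at h

theorem nonClassical_app {a : Act} {M A B : Term} (h : NonClassical a M (.app A B)) :
    QRedex a M (.app A B) ∨ (∃ A', M = .app A' B ∧ NonClassical a A' A) ∨
      ∃ B', M = .app A B' ∧ NonClassical a B' B := by
  cases h with
  | root hr =>
    rcases nonClassical_root hr with h | ⟨k, r, h⟩
    · exact Or.inl h
    · cases k <;> simp [qtuple] at h
  | appL h => exact Or.inr (Or.inl ⟨_, rfl, h⟩)
  | appR h => exact Or.inr (Or.inr ⟨_, rfl, h⟩)

theorem Ctx.reflect_inst {S : Set Label} {a : Act} (hS : ∀ α ∈ S, α ∉ quantumLabels) {k : ℕ}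
    {P M : Term} {r : Fin k → ℕ} (h : Ctx (RootIn S a) (P.inst fun i => .qvar (r i)) M) :
    ∃ P', Ctx (RootIn S a) P P' ∧ P'.inst (fun i => .qvar (r i)) = M := by
  obtain ⟨α, hα, h⟩ := ctx_rootIn_iff.1 h
  obtain ⟨P', h1, h2⟩ := h.reflect (hS α hα) (rigid_qvars r)
  exact ⟨P', ctx_rootIn_iff.2 ⟨α, hα, h1⟩, h2⟩

/-- The classical step is reflected into the body `P` and made there, before the redex is
contracted. Starting from a term that merely reduces to the redex leaves room for the conversions
that first enlarge its body. -/
theorem Classical.permute_qbeta {n : ℕ} {r : Fin (n + 2) → ℕ} {M P M₁ M₂ : Term}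
    (hp : ReflTransGen Classical M (.app (.lam (.tup n) P) (.tuple n fun i => .qvar (r i))))
    (e : P.inst (fun i => .qvar (r i)) = M₁) (h : Classical M₁ M₂) :
    ∃ M', ReflTransGen Classical M M' ∧ NonClassical .id M' M₂ := by
  subst e
  obtain ⟨P', h1, rfl⟩ := Ctx.reflect_inst (by simp [classicalLabels, quantumLabels]) h
  exact ⟨_, hp.tail (.appL (.inLam h1)),
    .root ⟨.qbeta, by simp [nonClassicalLabels, quantumLabels], .qbeta n P' r⟩⟩

theorem inst_app_shift_right {k : ℕ} (P L : Term) (N : Fin k → Term) :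
    (Term.app P (L.shift k)).inst N = .app (P.inst N) L := by
  have := shift_inst L N
  simp only [Term.inst, Term.subst] at *
  rw [this]

theorem inst_app_shift_left {k : ℕ} (P L : Term) (N : Fin k → Term) :
    (Term.app (L.shift k) P).inst N = .app L (P.inst N) := by
  have := shift_inst L N
  simp only [Term.inst, Term.subst] at *
  rw [this]

theorem classical_lcm (p : Pat) (L M N : Term) :
    Classical (.app L (.app (.lam p M) N)) (.app (.lam p (.app (L.shift p.arity) M)) N) :=
  .root ⟨.lcm, by simp [classicalLabels], .lcm p L M N⟩

theorem classical_rcm (p : Pat) (L M N : Term) :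
    Classical (.app (.app (.lam p M) N) L) (.app (.lam p (.app M (L.shift p.arity))) N) :=
  .root ⟨.rcm, by simp [classicalLabels], .rcm p L M N⟩

theorem rtg_inTuple {R : Term → Term → Prop} {n : ℕ} {M : Fin (n + 2) → Term} {i : Fin (n + 2)}
    {M' : Term} (h : ReflTransGen (Ctx R) (M i) M') :
    ReflTransGen (Ctx R) (.tuple n M) (.tuple n (Function.update M i M')) := by
  induction h with
  | refl => rw [Function.update_eq_self]
  | @tail A B _ h ih =>
    refine ih.tail ?_
    have := Ctx.inTuple (n := n) (M := Function.update M i A) (M' := B) i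
      (by rwa [Function.update_self])
    rwa [Function.update_idem] at this

/-- If the classical redex was there before, the two steps commute and the non classical one is
neither copied nor lost. Otherwise a `qbeta` step has uncovered an abstraction, a bang or an
application that completes the redex, and commuting conversions bring the whole classical redex into
the body beforehand. -/
theorem Classical.permute {a : Act} {M M₁ M₂ : Term} (hM : M.LamOK) (h₁ : NonClassical a M M₁)
    (h₂ : Classical M₁ M₂) :
    ∃ M', ReflTransGen Classical M M' ∧ NonClassical a M' M₂ := by
  have st := RootIn.substStable nonClassicalLabels a
  induction M generalizing M₁ M₂ with
  | var | qvar | bit | gate | bang =>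
    cases h₁ with | root hr => obtain ⟨α, hα, hr⟩ := hr; cases hr
  | new M ih =>
    cases h₁ with
    | root hr =>
      obtain ⟨α, hα, hr⟩ := hr
      cases hr
      cases h₂ with | root hr => obtain ⟨α, hα, hr⟩ := hr; cases hr
    | inNew h₁ =>
      cases h₂ with
      | root hr =>
        obtain ⟨α, hα, hr⟩ := hr
        cases hr
      | inNew h₂ =>
        obtain ⟨M', h, h'⟩ := ih hM h₁ h₂
        exact ⟨_, h.lift Term.new fun _ _ => .inNew, .inNew h'⟩
  | lamBang M ih =>
    cases h₁ with
    | root hr => obtain ⟨α, hα, hr⟩ := hr; cases hr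
    | inLamBang h₁ =>
      cases h₂ with
      | root hr => obtain ⟨α, hα, hr⟩ := hr; cases hr
      | inLamBang h₂ =>
        obtain ⟨M', h, h'⟩ := ih hM h₁ h₂
        exact ⟨_, h.lift Term.lamBang fun _ _ => .inLamBang, .inLamBang h'⟩
  | lam p M ih =>
    cases h₁ with
    | root hr => obtain ⟨α, hα, hr⟩ := hr; cases hr
    | inLam h₁ =>
      cases h₂ with
      | root hr => obtain ⟨α, hα, hr⟩ := hr; cases hr
      | inLam h₂ =>
        obtain ⟨M', h, h'⟩ := ih hM.1 h₁ h₂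
        exact ⟨_, h.lift (Term.lam p) fun _ _ => .inLam, .inLam h'⟩
  | tuple n M ih =>
    cases h₁ with
    | root hr => obtain ⟨α, hα, hr⟩ := hr; cases hr
    | @inTuple _ _ A i h₁ =>
      cases h₂ with
      | root hr => obtain ⟨α, hα, hr⟩ := hr; cases hr
      | @inTuple _ _ B j h₂ =>
        by_cases hij : j = i
        · subst hij
          rw [Function.update_self] at h₂
          obtain ⟨M', h, h'⟩ := ih j (hM j) h₁ h₂
          refine ⟨_, rtg_inTuple h, ?_⟩
          have := Ctx.inTuple (n := n) (M := Function.update M j M') (M' := B) j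
            (R := RootIn nonClassicalLabels a) (by rwa [Function.update_self])
          rwa [Function.update_idem] at this ⊢
        · rw [Function.update_of_ne hij] at h₂
          refine ⟨_, .single (.inTuple j h₂), ?_⟩
          rw [Function.update_comm (Ne.symm hij)]
          exact .inTuple i (by rwa [Function.update_of_ne (Ne.symm hij)])
  | app A B ihA ihB =>
    cases h₁ with
    | root hr =>
      obtain ⟨α, hα, hr⟩ := hr
      cases hr with
      | Uq u k r =>
        obtain ⟨β, -, h₂⟩ := ctx_rootIn_iff.1 h₂
        exact absurd h₂ qtuple_normal
      | qbeta n P r => exact Classical.permute_qbeta .refl rfl h₂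
      | _ => simp [nonClassicalLabels, quantumLabels] at hα
    | @appL _ A₁ _ hA =>
      -- When the function itself is the `qbeta` redex, `rcm` moves `B` into its body. Contracting
      -- then yields the same application, since the shifted `B` is untouched by the substitution.
      have key : QRedex a A A₁ → ∃ M', ReflTransGen Classical (.app A B) M' ∧
          NonClassical a M' M₂ := by
        rintro ⟨n, P, r, rfl, rfl, rfl⟩
        exact Classical.permute_qbeta (.single (classical_rcm _ _ _ _))
          (inst_app_shift_right _ _ _) h₂
      cases h₂ with
      | root hr =>
        have hr' := hr
        obtain ⟨α, hα, hr⟩ := hr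
        cases hr with
        | qbeta => simp [classicalLabels] at hα
        | lbeta P N =>
          rcases nonClassical_lam hA with h | ⟨P', rfl, h⟩
          · exact key h
          · exact ⟨_, .single (.root ⟨_, hα, .lbeta P' B⟩), h.subst st _⟩
        | cbeta P N =>
          rcases nonClassical_lamBang hA with h | ⟨P', rfl, h⟩
          · exact key h
          · exact ⟨_, .single (.root ⟨_, hα, .cbeta P' N⟩), h.subst st _⟩
        | lcm p L P N =>
          exact ⟨_, .single (classical_lcm p A P N), .appL (.inLam (.appL (hA.shift st _)))⟩
        | rcm p L P N =>
          rcases nonClassical_app hA with h | ⟨X, rfl, h⟩ | ⟨N', rfl, h⟩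
          · exact key h
          · rcases nonClassical_lam h with ⟨n, Q, r, rfl, rfl, e⟩ | ⟨P', rfl, h'⟩
            -- The uncovered abstraction is two applications away from the outer argument, so `rcm`
            -- is needed twice, once for each argument.
            · refine Classical.permute_qbeta (.tail (.single (.appL (classical_rcm _ _ _ _)))
                (classical_rcm _ _ _ _)) ?_ (.root hr')
              rw [Pat.arity, inst_app_shift_right, inst_app_shift_right, e]
            · exact ⟨_, .single (classical_rcm p B P' N), .appL (.inLam (.appL h'))⟩
          · exact ⟨_, .single (classical_rcm p B P N'), .appR h⟩
      | appL h₂ =>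
        obtain ⟨M', h, h'⟩ := ihA hM.1 hA h₂
        exact ⟨_, h.lift (Term.app · B) fun _ _ => .appL, .appL h'⟩
      | appR h₂ => exact ⟨_, .single (.appR h₂), .appL hA⟩
    | @appR _ _ B₁ hB =>
      have key : QRedex a B B₁ → ∃ M', ReflTransGen Classical (.app A B) M' ∧
          NonClassical a M' M₂ := by
        rintro ⟨n, P, r, rfl, rfl, rfl⟩
        exact Classical.permute_qbeta (.single (classical_lcm _ _ _ _))
          (inst_app_shift_left _ _ _) h₂
      cases h₂ with
      | root hr =>
        have hr' := hr
        obtain ⟨α, hα, hr⟩ := hr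
        cases hr with
        | qbeta => simp [classicalLabels] at hα
        | lbeta P N =>
          -- The argument still to be reduced is substituted for a linear variable, so a single step
          -- remains to be done.
          refine ⟨_, .single (.root ⟨_, hα, .lbeta P B⟩), ?_⟩
          refine Ctx.subst_linear (x := 0) st (by simpa using hB) (fun y hy => ?_)
            (hM.1.2 0 (by simp [Pat.arity]))
          have : ¬ y < 1 := by omega
          simp [this]
        -- Nothing reduces under `!`, so a bang that results from a step is the contracted `qbeta`
        -- redex itself.
        | cbeta P N => exact key (nonClassical_bang hB)
        | lcm p L P N =>
          rcases nonClassical_app hB with h | ⟨X, rfl, h⟩ | ⟨N', rfl, h⟩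
          · exact key h
          · rcases nonClassical_lam h with ⟨n, Q, r, rfl, rfl, e⟩ | ⟨P', rfl, h'⟩
            · refine Classical.permute_qbeta (.tail (.single (.appR (classical_rcm _ _ _ _)))
                (classical_lcm _ _ _ _)) ?_ (.root hr')
              rw [Pat.arity, inst_app_shift_left, inst_app_shift_right, e]
            · exact ⟨_, .single (classical_lcm p A P' N), .appL (.inLam (.appR h'))⟩
          · exact ⟨_, .single (classical_lcm p A P N'), .appR h⟩
        | rcm p L P N =>
          exact ⟨_, .single (classical_rcm p B P N), .appL (.inLam (.appR (hB.shift st _)))⟩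
      | appL h₂ => exact ⟨_, .single (.appL h₂), .appR hB⟩
      | appR h₂ =>
        obtain ⟨M', h, h'⟩ := ihB hM.2 hB h₂
        exact ⟨_, h.lift (Term.app A) fun _ _ => .appR, .appR h'⟩

/-! ### Creations of quantum variables can be performed before quantum reductions -/

/-- Quantum reduction of terms. -/
def Quantum (a : Act) : Term → Term → Prop := Ctx (RootIn quantumLabels a)

/-- A body whose instance is a bit is that bit already, and then it does not use the variables of
its pattern, against linearity. Gates return quantum variables. -/
theorem Quantum.ne_bit {a : Act} {M : Term} {c : Bool} (hM : M.LamOK) :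
    ¬ Quantum a M (.bit c) := by
  intro h
  cases h with
  | root hr =>
    obtain ⟨α, hα, hr⟩ := hr
    generalize hN : Term.bit c = N at hr
    cases hr with
    | Uq u k r => cases k <;> simp [qtuple] at hN
    | qbeta n P r =>
      obtain rfl := (rigid_qvars r).bit_inv hN.symm
      have := hM.1.2 0 (by simp [Pat.arity])
      simp [occ, wt] at this
    | _ => simp [quantumLabels] at hα

/-- A quantum step cannot create a redex of `new`: no bit arises from it, and `qbeta` substitutes
only quantum variables. So the redex is either apart from the quantum one or in the body of its
abstraction, and the swap is one for one. -/
theorem Quantum.permute_new {a : Act} {c : Bool} {s : ℕ} {M M₁ M₂ : Term} (hM : M.LamOK)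
    (h₁ : Quantum a M M₁) (h₂ : Ctx (Root .new (.new c s)) M₁ M₂) :
    ∃ M', Ctx (Root .new (.new c s)) M M' ∧ Quantum a M' M₂ := by
  induction M generalizing M₁ M₂ with
  | var | qvar | bit | gate | bang =>
    cases h₁ with | root hr => obtain ⟨α, hα, hr⟩ := hr; cases hr
  | new M ih =>
    cases h₁ with
    | root hr =>
      obtain ⟨α, hα, hr⟩ := hr
      cases hr
      simp [quantumLabels] at hα
    | inNew h₁ =>
      cases h₂ with
      | root hr =>
        cases hr
        exact absurd h₁ (Quantum.ne_bit hM)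
      | inNew h₂ =>
        obtain ⟨M', h, h'⟩ := ih hM h₁ h₂
        exact ⟨_, .inNew h, .inNew h'⟩
  | lamBang M ih =>
    cases h₁ with
    | root hr => obtain ⟨α, hα, hr⟩ := hr; cases hr
    | inLamBang h₁ =>
      cases h₂ with
      | root hr => cases hr
      | inLamBang h₂ =>
        obtain ⟨M', h, h'⟩ := ih hM h₁ h₂
        exact ⟨_, .inLamBang h, .inLamBang h'⟩
  | lam p M ih =>
    cases h₁ with
    | root hr => obtain ⟨α, hα, hr⟩ := hr; cases hr
    | inLam h₁ =>
      cases h₂ with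
      | root hr => cases hr
      | inLam h₂ =>
        obtain ⟨M', h, h'⟩ := ih hM.1 h₁ h₂
        exact ⟨_, .inLam h, .inLam h'⟩
  | tuple n M ih =>
    cases h₁ with
    | root hr => obtain ⟨α, hα, hr⟩ := hr; cases hr
    | @inTuple _ _ A i h₁ =>
      cases h₂ with
      | root hr => cases hr
      | @inTuple _ _ B j h₂ =>
        by_cases hij : j = i
        · subst hij
          rw [Function.update_self] at h₂
          obtain ⟨M', h, h'⟩ := ih j (hM j) h₁ h₂
          refine ⟨_, .inTuple j h, ?_⟩
          have := Ctx.inTuple (n := n) (M := Function.update M j M') (M' := B) j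
            (R := RootIn quantumLabels a) (by rwa [Function.update_self])
          rwa [Function.update_idem] at this ⊢
        · rw [Function.update_of_ne hij] at h₂
          refine ⟨_, .inTuple j h₂, ?_⟩
          rw [Function.update_comm (Ne.symm hij)]
          exact .inTuple i (by rwa [Function.update_of_ne (Ne.symm hij)])
  | app A B ihA ihB =>
    cases h₁ with
    | root hr =>
      obtain ⟨α, hα, hr⟩ := hr
      cases hr with
      | Uq u k r => exact absurd h₂ qtuple_normal
      | qbeta n P r =>
        obtain ⟨P', h, rfl⟩ := Ctx.reflect (by simp [quantumLabels]) (rigid_qvars r) h₂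
        exact ⟨_, .appL (.inLam h), .root ⟨_, hα, .qbeta n P' r⟩⟩
      | _ => simp [quantumLabels] at hα
    | appL hA =>
      cases h₂ with
      | root hr => cases hr
      | appL h₂ =>
        obtain ⟨M', h, h'⟩ := ihA hM.1 hA h₂
        exact ⟨_, .appL h, .appL h'⟩
      | appR h₂ => exact ⟨_, .appR h₂, .appL hA⟩
    | appR hB =>
      cases h₂ with
      | root hr => cases hr
      | appL h₂ => exact ⟨_, .appL h₂, .appR hB⟩
      | appR h₂ =>
        obtain ⟨M', h, h'⟩ := ihB hM.2 hB h₂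
        exact ⟨_, .appR h, .appR h'⟩

/-! ### Classical and quantum reductions have different results -/

/-- Arguments that do not reduce, and are not substitution instances of terms that reduce. -/
def Inert (B : Term) : Prop :=
  (∃ x, B = .var x) ∨ (∃ N, B = .bang N) ∨
    ∃ (n : ℕ) (M : Fin (n + 2) → Term), B = .tuple n M ∧
      ∀ i, (∃ x, M i = .var x) ∨ ∃ r, M i = .qvar r

theorem Inert.of_subst {B : Term} {σ : ℕ → Term} (h : Inert (B.subst σ)) : Inert B := by
  rcases h with ⟨x, h⟩ | ⟨N, h⟩ | ⟨n, M, h, hM⟩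
  · cases B <;> simp [Term.subst, Inert] at *
  · cases B <;> simp [Term.subst, Inert] at *
  · cases B with
    | var x => exact Or.inl ⟨x, rfl⟩
    | tuple m A =>
      simp only [Term.subst, Term.tuple.injEq] at h
      obtain ⟨rfl, h⟩ := h
      refine Or.inr (Or.inr ⟨m, A, rfl, fun i => ?_⟩)
      have hi := congr_fun (eq_of_heq h) i
      rcases hM i with ⟨x, hx⟩ | ⟨r, hr⟩
      · rw [hx] at hi
        cases hA : A i <;> simp [hA, Term.subst] at hi ⊢
      · rw [hr] at hi
        cases hA : A i <;> simp [hA, Term.subst] at hi ⊢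
    | _ => simp [Term.subst] at h

theorem Inert.normal {B B' : Term} {α : Label} {a : Act} (h : Inert B) :
    ¬ Ctx (Root α a) B B' := by
  rcases h with ⟨x, rfl⟩ | ⟨N, rfl⟩ | ⟨n, M, rfl, hM⟩ <;> intro h
  · cases h with | root hr => cases hr
  · cases h with | root hr => cases hr
  · cases h with
    | root hr => cases hr
    | inTuple i h =>
      rcases hM i with ⟨x, hx⟩ | ⟨r, hx⟩ <;> rw [hx] at h <;>
        cases h with | root hr => cases hr

theorem inert_qvars {n : ℕ} (r : Fin (n + 2) → ℕ) : Inert (.tuple n fun i => .qvar (r i)) :=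
  Or.inr (Or.inr ⟨n, _, rfl, fun i => Or.inr ⟨r i, rfl⟩⟩)

/-- This treats a quantum step inside the function of a `cbeta` redex. The two claims descend into
each other: the first strips an inert argument and becomes the second, the second strips a binder
and becomes the first, each time for a smaller reduction. The step cannot lie in the stripped
argument, which is normal, and a quantum redex at the root has the wrong head. -/
theorem Ctx.subst_ne_lamBang {α : Label} {a : Act} (hα : α ∈ quantumLabels) {P P' : Term}
    (h : Ctx (Root α a) P P') :
    (∀ σ B, Inert B → P.subst σ ≠ .app (.lamBang P') B) ∧
      ∀ σ B, Inert B → P.subst σ ≠ .lamBang (.app P' B) := by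
  induction h with
  | root hr => cases hr <;> simp [quantumLabels, Term.subst] at *
  | inTuple i _ ih => simp [Term.subst]
  | inNew _ ih => simp [Term.subst]
  | inLam _ ih => simp [Term.subst]
  | @appL A A' B _ ih =>
    refine ⟨fun σ B' hB' he => ?_, fun σ B' hB' he => ?_⟩
    · simp only [Term.subst, Term.app.injEq] at he
      exact ih.2 σ B (Inert.of_subst (he.2 ▸ hB')) he.1
    · simp [Term.subst] at he
  | @appR A B B' h ih =>
    refine ⟨fun σ B' hB' he => ?_, fun σ B' hB' he => ?_⟩
    · simp only [Term.subst, Term.app.injEq] at he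
      exact Inert.normal (Inert.of_subst (he.2 ▸ hB')) h
    · simp [Term.subst] at he
  | inLamBang _ ih =>
    refine ⟨fun σ B' hB' he => ?_, fun σ B' hB' he => ?_⟩
    · simp [Term.subst] at he
    · simp only [Term.subst, Term.lamBang.injEq] at he
      exact ih.1 _ B' hB' he

/-- The same descent with the roles exchanged, for a `cbeta` step in the body of a `qbeta` redex. -/
theorem Ctx.subst_ne_lam {a : Act} {P P' : Term} (h : Ctx (Root .cbeta a) P P') (p : Pat) :
    (∀ σ B, Inert B → P.subst σ ≠ .app (.lam p P') B) ∧
      ∀ σ B, Inert B → P.subst σ ≠ .lam p (.app P' B) := by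
  induction h with
  | root hr => cases hr; simp [Term.subst]
  | inTuple i _ ih => simp [Term.subst]
  | inNew _ ih => simp [Term.subst]
  | inLamBang _ ih => simp [Term.subst]
  | @appL A A' B _ ih =>
    refine ⟨fun σ B' hB' he => ?_, fun σ B' hB' he => ?_⟩
    · simp only [Term.subst, Term.app.injEq] at he
      exact ih.2 σ B (Inert.of_subst (he.2 ▸ hB')) he.1
    · simp [Term.subst] at he
  | @appR A B B' h ih =>
    refine ⟨fun σ B' hB' he => ?_, fun σ B' hB' he => ?_⟩
    · simp only [Term.subst, Term.app.injEq] at he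
      exact Inert.normal (Inert.of_subst (he.2 ▸ hB')) h
    · simp [Term.subst] at he
  | @inLam q _ _ _ ih =>
    refine ⟨fun σ B' hB' he => ?_, fun σ B' hB' he => ?_⟩
    · simp [Term.subst] at he
    · simp only [Term.subst, Term.lam.injEq] at he
      obtain ⟨rfl, he⟩ := he
      exact ih.1 _ B' hB' he

theorem Ctx.wt_quantum {α : Label} {a : Act} (hα : α ∈ quantumLabels) {M M' : Term}
    (h : Ctx (Root α a) M M') (hM : M.LamOK) : M'.wt 1 0 0 + 1 = M.wt 1 0 0 := by
  refine h.wt_eq (N := M.wt 1 0 0) (d := 0) (fun M M' w hr hM h1 => ?_) hM 0 le_rfl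
  have := hr.wt_eq hM 1 0 w (by rintro (rfl | rfl) <;> simp [quantumLabels] at hα)
  have ha : a.wt 0 = 0 := by cases a <;> rfl
  have hd : α.drop 1 = 1 := by rcases hα with rfl | rfl <;> rfl
  rwa [ha, hd] at this

theorem Ctx.quantum_ne_self {α : Label} {a : Act} (hα : α ∈ quantumLabels) {M : Term}
    (hM : M.LamOK) : ¬ Ctx (Root α a) M M := fun h => by
  have := h.wt_quantum hα hM
  omega

/-- Weights are of no direct use here, as `cbeta` may copy or erase gates. If the redexes lie in
different components, equal results would give a quantum step from a component to itself, which the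
weight does forbid. If one redex contains the other, the two preceding descents apply. -/
theorem Ctx.cbeta_ne_quantum {α : Label} {a b : Act} (hα : α ∈ quantumLabels) {M M₁ M₂ : Term}
    (hM : M.LamOK) (h₁ : Ctx (Root .cbeta b) M M₁) (h₂ : Ctx (Root α a) M M₂) : M₁ ≠ M₂ := by
  induction h₁ generalizing M₂ with
  | root hr =>
    cases hr with
    | cbeta P N =>
      cases h₂ with
      | root hr => cases hr; simp [quantumLabels] at hα
      | appL h =>
        cases h with
        | root hr => cases hr
        | inLamBang h => exact (h.subst_ne_lamBang hα).1 _ _ (Or.inr (Or.inl ⟨N, rfl⟩))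
      | appR h => cases h with | root hr => cases hr
  | @inTuple n M A i h₁ ih =>
    cases h₂ with
    | root hr => cases hr
    | @inTuple _ _ B j h₂ =>
      intro he
      simp only [Term.tuple.injEq, heq_eq_eq, true_and] at he
      have hj := congr_fun he j
      by_cases hij : j = i
      · subst hij
        simp only [Function.update_self] at hj
        exact ih (hM j) h₂ hj
      · rw [Function.update_self, Function.update_of_ne hij] at hj
        rw [← hj] at h₂
        exact Ctx.quantum_ne_self hα (hM j) h₂
  | appL h₁ ih =>
    cases h₂ with
    | root hr =>
      cases hr with
      | Uq => cases h₁ with | root hr => cases hr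
      | qbeta n P r =>
        cases h₁ with
        | root hr => cases hr
        | inLam h₁ => exact ((h₁.subst_ne_lam _).1 _ _ (inert_qvars r)).symm
      | _ => simp [quantumLabels] at hα
    | appL h₂ =>
      intro he
      simp only [Term.app.injEq, and_true] at he
      exact ih hM.1 h₂ he
    | appR h₂ =>
      intro he
      simp only [Term.app.injEq] at he
      rw [← he.2] at h₂
      exact Ctx.quantum_ne_self hα hM.2 h₂
  | appR h₁ ih =>
    cases h₂ with
    | root hr =>
      cases hr with
      | Uq => exact absurd h₁ qtuple_normal
      | qbeta n P r => exact absurd h₁ (inert_qvars r).normal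
      | _ => simp [quantumLabels] at hα
    | appL h₂ =>
      intro he
      simp only [Term.app.injEq] at he
      rw [← he.1] at h₂
      exact Ctx.quantum_ne_self hα hM.1 h₂
    | appR h₂ =>
      intro he
      simp only [Term.app.injEq, true_and] at he
      exact ih hM.2 h₂ he
  | inNew h₁ ih =>
    cases h₂ with
    | root hr => cases hr; simp [quantumLabels] at hα
    | inNew h₂ => simpa using ih hM h₂
  | inLam h₁ ih =>
    cases h₂ with
    | root hr => cases hr
    | inLam h₂ => simpa using ih hM.1 h₂
  | inLamBang h₁ ih =>
    cases h₂ with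
    | root hr => cases hr
    | inLamBang h₂ => simpa using ih hM h₂

/-- The weight that counts gates and tuple abstractions drops by one in a quantum step and is kept
by every classical rule except `cbeta`. -/
theorem Ctx.classical_ne_quantum {α β : Label} {a b : Act} (hα : α ∈ quantumLabels)
    (hβ : β ∈ classicalLabels) {M M₁ M₂ : Term} (hM : M.LamOK) (h₁ : Ctx (Root β b) M M₁)
    (h₂ : Ctx (Root α a) M M₂) : M₁ ≠ M₂ := by
  by_cases hc : β = .cbeta
  · subst hc
    exact Ctx.cbeta_ne_quantum hα hM h₁ h₂
  · rintro rfl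
    have h3 := h₂.wt_quantum hα hM
    have h4 : M₁.wt 1 0 0 + 0 = M.wt 1 0 0 + 0 := by
      refine h₁.wt_eq (N := M.wt 1 0 0) (fun M M' w hr hM h1 => ?_) hM 0 le_rfl
      have hq : β.drop 1 = 0 ∧ β ≠ .new := by
        rcases hβ with rfl | rfl | rfl | rfl <;> simp [Label.drop]
      have := hr.wt_eq hM 1 0 w (by rintro (h | h); exacts [absurd h hc, absurd h hq.2])
      have hb : b.wt 0 = 0 := by cases b <;> rfl
      rwa [hq.1, hb] at this
    omega

end QCalculus
end

noncomputable section
namespace QCalculus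
open Term Relation

/-! ## Reduction of preconfigurations -/

/-- The effect of an action on the quantum register. -/
inductive RegStep (G : GateFamily) :
    Act → (V : Finset ℕ) → Hilb V → (V' : Finset ℕ) → Hilb V' → Prop
  | id (V : Finset ℕ) (φ : Hilb V) : RegStep G .id V φ V φ
  | gate {V : Finset ℕ} (φ : Hilb V) {u k : ℕ} {U : Matrix.unitaryGroup (Fin (k + 1) → Bool) ℂ}
      {r : Fin (k + 1) → ℕ} (hr : ∀ i, r i ∈ V) (hU : G u = ⟨k + 1, U⟩) :
      RegStep G (.gate u k r) V φ V (applyGate U.1 r hr φ)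
  | new {V : Finset ℕ} (φ : Hilb V) (c : Bool) {r : ℕ} (hr : r ∉ V) :
      RegStep G (.new c r) V φ (insert r V) (addQubit φ r c)

/-- Reduction of preconfigurations by a rule with label in `S`. -/
def StepIn (G : GateFamily) (S : Set Label) (c d : PreConfig) : Prop :=
  ∃ a, Ctx (RootIn S a) c.term d.term ∧ RegStep G a c.qv c.reg d.qv d.reg

theorem stepIn_iff {G : GateFamily} {S : Set Label} {c d : PreConfig} :
    StepIn G S c d ↔ ∃ α ∈ S, StepIn G {α} c d := by
  simp only [StepIn, ctx_rootIn_iff]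
  constructor
  · rintro ⟨a, ⟨α, hα, h⟩, h'⟩
    exact ⟨α, hα, a, ⟨α, rfl, h⟩, h'⟩
  · rintro ⟨α, hα, a, ⟨_, rfl, h⟩, h'⟩
    exact ⟨a, ⟨_, hα, h⟩, h'⟩

theorem StepIn.mono {G : GateFamily} {S T : Set Label} (hST : S ⊆ T) {c d : PreConfig}
    (h : StepIn G S c d) : StepIn G T c d := by
  rw [stepIn_iff] at *
  exact h.imp fun _ h => ⟨hST h.1, h.2⟩

theorem Step.stepIn {G : GateFamily} {α : Label} {c d : PreConfig} (h : Step G α c d) :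
    StepIn G {α} c d := by
  induction h with
  | inTuple i _ _ ih => obtain ⟨a, h, h'⟩ := ih; exact ⟨a, .inTuple i h, h'⟩
  | appR _ _ ih => obtain ⟨a, h, h'⟩ := ih; exact ⟨a, .appR h, h'⟩
  | appL _ _ ih => obtain ⟨a, h, h'⟩ := ih; exact ⟨a, .appL h, h'⟩
  | inNew _ ih => obtain ⟨a, h, h'⟩ := ih; exact ⟨a, .inNew h, h'⟩
  | inLam _ ih => obtain ⟨a, h, h'⟩ := ih; exact ⟨a, .inLam h, h'⟩
  | inLamBang _ ih => obtain ⟨a, h, h'⟩ := ih; exact ⟨a, .inLamBang h, h'⟩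
  | Uq hr _ hU => exact ⟨_, .root ⟨_, rfl, .Uq _ _ _⟩, .gate _ hr hU⟩
  | new _ hr => exact ⟨_, .root ⟨_, rfl, .new _ _⟩, .new _ _ hr⟩
  | lbeta _ => exact ⟨_, .root ⟨_, rfl, .lbeta _ _⟩, .id _ _⟩
  | qbeta _ => exact ⟨_, .root ⟨_, rfl, .qbeta _ _ _⟩, .id _ _⟩
  | cbeta _ => exact ⟨_, .root ⟨_, rfl, .cbeta _ _⟩, .id _ _⟩
  | lcm _ => exact ⟨_, .root ⟨_, rfl, .lcm _ _ _ _⟩, .id _ _⟩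
  | rcm _ => exact ⟨_, .root ⟨_, rfl, .rcm _ _ _ _⟩, .id _ _⟩

/-- The side conditions at the inner nodes follow from the outermost one, because `Good` passes to
the subterms. -/
theorem Ctx.step {G : GateFamily} {α : Label} {a : Act} {M M' : Term} (h : Ctx (Root α a) M M')
    {V V' : Finset ℕ} {φ : Hilb V} {φ' : Hilb V'} (hreg : RegStep G a V φ V' φ')
    (hq : M.qvars ⊆ V) (hM : M.Good) : Step G α ⟨V, φ, M⟩ ⟨V', φ', M'⟩ := by
  have hok : PreConfig.Ok ⟨V, φ, M⟩ := PreConfig.ok_iff.2 ⟨hq, hM⟩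
  induction h with
  | root hr =>
    cases hr with
    | Uq u k r => cases hreg with | gate _ hr hU => exact .Uq hr hok hU
    | new c r => cases hreg with | new _ _ hr => exact .new hok hr
    | lbeta M N => cases hreg; exact .lbeta hok
    | qbeta n M r => cases hreg; exact .qbeta hok
    | cbeta M N => cases hreg; exact .cbeta hok
    | lcm p L M N => cases hreg; exact .lcm hok
    | rcm p L M N => cases hreg; exact .rcm hok
  | @inTuple n M M' i _ ih =>
    have hqi : (M i).qvars ⊆ V := (Finset.subset_biUnion_of_mem _ (Finset.mem_univ i)).trans hq
    have hMi : (M i).Good := ⟨hM.1 i, fun r => le_trans (Finset.single_le_sum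
      (f := fun i => (M i).qocc r) (fun _ _ => Nat.zero_le _) (Finset.mem_univ i)) (hM.2 r)⟩
    exact .inTuple i (ih hqi hMi (PreConfig.ok_iff.2 ⟨hqi, hMi⟩)) hok
  | @appL A A' B _ ih =>
    have hqi : A.qvars ⊆ V := Finset.subset_union_left.trans hq
    have hMi : A.Good := ⟨hM.1.1, fun r => le_trans (Nat.le_add_right _ _) (hM.2 r)⟩
    exact .appL (ih hqi hMi (PreConfig.ok_iff.2 ⟨hqi, hMi⟩)) hok
  | @appR A B B' _ ih =>
    have hqi : B.qvars ⊆ V := Finset.subset_union_right.trans hq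
    have hMi : B.Good := ⟨hM.1.2, fun r => le_trans (Nat.le_add_left _ _) (hM.2 r)⟩
    exact .appR (ih hqi hMi (PreConfig.ok_iff.2 ⟨hqi, hMi⟩)) hok
  | inNew _ ih => exact .inNew (ih hq hM (PreConfig.ok_iff.2 ⟨hq, hM⟩))
  | @inLam p M _ _ ih =>
    have hMi : M.Good := ⟨hM.1.1, fun r => by
      have := hM.2 r
      cases p <;> simpa [Term.qocc, Term.wt, under_zero] using this⟩
    exact .inLam (ih hq hMi (PreConfig.ok_iff.2 ⟨hq, hMi⟩))
  | @inLamBang M _ _ ih =>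
    have hMi : M.Good := ⟨hM.1, fun r => by simpa [Term.qocc, Term.wt, under_zero] using hM.2 r⟩
    exact .inLamBang (ih hq hMi (PreConfig.ok_iff.2 ⟨hq, hMi⟩))

theorem StepIn.step {G : GateFamily} {α : Label} {c d : PreConfig} (h : StepIn G {α} c d)
    (hc : c.Ok) : Step G α c d := by
  obtain ⟨a, h, hreg⟩ := h
  obtain ⟨_, rfl, h'⟩ := ctx_rootIn_iff.1 h
  rw [PreConfig.ok_iff] at hc
  exact h'.step hreg hc.1 hc.2

theorem StepIn.ok {G : GateFamily} {S : Set Label} {c d : PreConfig} (h : StepIn G S c d)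
    (hc : c.Ok) : d.Ok := by
  obtain ⟨V, φ, M⟩ := c
  obtain ⟨V', φ', M'⟩ := d
  obtain ⟨a, h, hreg⟩ := h
  obtain ⟨α, -, h⟩ := ctx_rootIn_iff.1 h
  rw [PreConfig.ok_iff] at hc ⊢
  obtain ⟨hq, hM⟩ := hc
  have hocc := h.qocc hM
  have hlam := h.lamOK hM.1
  -- A variable created by `new` is outside `V`, so its count rises from `0` to `1` and stays
  -- linear.
  have h0 : ∀ r, r ∉ V → M.qocc r = 0 := fun r hr => by
    by_contra hne
    exact hr (hq (mem_qvars.2 hne))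
  cases hreg with
  | @new _ _ c r hr =>
    simp only [Act.wt] at hocc
    refine ⟨fun s hs => ?_, hlam, fun s => ?_⟩
    · rw [mem_qvars, hocc] at hs
      by_contra hsV
      have hsV : s ∉ insert r V := hsV
      rw [Finset.mem_insert, not_or] at hsV
      rw [h0 s hsV.2, Pi.single_eq_of_ne (Ne.symm hsV.1)] at hs
      exact hs rfl
    · rw [hocc]
      have := hM.2 s
      by_cases hs : s = r
      · subst hs
        rw [h0 _ hr, Pi.single_eq_same]
      · rw [Pi.single_eq_of_ne (Ne.symm hs)]
        exact this
  | _ =>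
    simp only [Act.wt, add_zero] at hocc
    refine ⟨fun s hs => ?_, hlam, fun s => ?_⟩
    · rw [mem_qvars, hocc, ← mem_qvars] at hs
      exact hq hs
    · rw [hocc]
      exact hM.2 s

/-! ### Renaming of quantum variables -/

/-- The action with renamed quantum variables. -/
def Act.map (f : ℕ → ℕ) : Act → Act
  | .id => .id
  | .gate u k r => .gate u k (f ∘ r)
  | .new c r => .new c (f r)

theorem Root.mapQ {α : Label} {a : Act} {M M' : Term} (h : Root α a M M') (f : ℕ → ℕ) :
    Root α (a.map f) (M.mapQ f) (M'.mapQ f) := by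
  cases h with
  | Uq u k r => simpa only [Term.mapQ, mapQ_qtuple, Act.map] using Root.Uq u k (f ∘ r)
  | new c r => exact .new c (f r)
  | lbeta M N => rw [mapQ_inst]; exact .lbeta _ _
  | qbeta n M r => rw [mapQ_inst]; exact .qbeta n _ (f ∘ r)
  | cbeta M N => rw [mapQ_inst]; exact .cbeta _ _
  | lcm p L M N => simp only [Term.mapQ, Term.shift, mapQ_rename]; exact .lcm p _ _ _
  | rcm p L M N => simp only [Term.mapQ, Term.shift, mapQ_rename]; exact .rcm p _ _ _

theorem Ctx.mapQ {S : Set Label} {a : Act} {M M' : Term} (h : Ctx (RootIn S a) M M')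
    (f : ℕ → ℕ) : Ctx (RootIn S (a.map f)) (M.mapQ f) (M'.mapQ f) := by
  induction h with
  | root hr => obtain ⟨α, hα, hr⟩ := hr; exact .root ⟨α, hα, hr.mapQ f⟩
  | @inTuple n M M' i _ ih =>
    have : (Term.tuple n (Function.update M i M')).mapQ f =
        .tuple n (Function.update (fun j => (M j).mapQ f) i (M'.mapQ f)) := by
      simp only [Term.mapQ]
      congr 1
      funext j
      exact Function.apply_update (fun _ P => Term.mapQ f P) M i M' j
    rw [this]
    exact .inTuple i ih
  | appL _ ih => exact .appL ih
  | appR _ ih => exact .appR ih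
  | inNew _ ih => exact .inNew ih
  | inLam _ ih => exact .inLam ih
  | inLamBang _ ih => exact .inLamBang ih

theorem applyGate_mapHilb {V V' : Finset ℕ} {n : ℕ} (U : Matrix (Fin n → Bool) (Fin n → Bool) ℂ)
    (θ : V ≃ V') {r r' : Fin n → ℕ} (hr : ∀ i, r i ∈ V) (hr' : ∀ i, r' i ∈ V')
    (h : ∀ i, r' i = θ ⟨r i, hr i⟩) (φ : Hilb V) :
    applyGate U r' hr' (mapHilb θ φ) = mapHilb θ (applyGate U r hr φ) := by
  ext g
  simp only [applyGate, mapHilb, PiLp.toLp_apply]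
  refine Finset.sum_congr rfl fun b _ => ?_
  have h1 : (fun i => g ⟨r' i, hr' i⟩) = fun i => (g ∘ θ) ⟨r i, hr i⟩ := by
    funext i
    exact congr_arg g (Subtype.ext (h i))
  have h2 : override g r' b ∘ θ = override (g ∘ θ) r b := by
    funext q
    -- The index chosen in `override` depends only on this predicate, so equal predicates give equal
    -- choices and injectivity of `r` is not needed.
    have hp : (fun i => r' i = (θ q : ℕ)) = fun i => r i = (q : ℕ) := by
      funext i
      rw [h i, eq_iff_iff, Subtype.val_inj, θ.apply_eq_iff_eq]
      exact Subtype.ext_iff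
    simp only [override, Function.comp_apply, hp]
  rw [h1, h2]

theorem addQubit_mapHilb {V V' : Finset ℕ} {r s : ℕ} (θ : V ≃ V')
    (θ' : (insert r V : Finset ℕ) ≃ (insert s V' : Finset ℕ))
    (hr : (θ' ⟨r, Finset.mem_insert_self r V⟩ : ℕ) = s)
    (hθ : ∀ q : V, (θ' ⟨q, Finset.mem_insert_of_mem q.2⟩ : ℕ) = θ q) (φ : Hilb V) (c : Bool) :
    addQubit (mapHilb θ φ) s c = mapHilb θ' (addQubit φ r c) := by
  ext g
  have h1 : θ' ⟨r, Finset.mem_insert_self r V⟩ = ⟨s, Finset.mem_insert_self s V'⟩ := Subtype.ext hr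
  have h2 : ∀ q : V, θ' ⟨q, Finset.mem_insert_of_mem q.2⟩ =
      ⟨θ q, Finset.mem_insert_of_mem (θ q).2⟩ := fun q => Subtype.ext (hθ q)
  simp only [addQubit, mapHilb, PiLp.toLp_apply, Function.comp_def, h1, h2]

/-- The gate leaves the bit of `s` alone. This is the register side of exchanging `Uq` with `new`.
-/
theorem applyGate_addQubit {V : Finset ℕ} {n : ℕ} (U : Matrix (Fin n → Bool) (Fin n → Bool) ℂ)
    {r : Fin n → ℕ} (hr : ∀ i, r i ∈ V) {s : ℕ} (hs : s ∉ V) (φ : Hilb V) (c : Bool) :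
    applyGate U r (fun i => Finset.mem_insert_of_mem (hr i)) (addQubit φ s c) =
      addQubit (applyGate U r hr φ) s c := by
  ext g
  have h : ∀ b, override g r b ⟨s, Finset.mem_insert_self s V⟩ =
      g ⟨s, Finset.mem_insert_self s V⟩ := fun b => by
    have : ¬ ∃ i, r i = s := by
      rintro ⟨i, rfl⟩
      exact hs (hr i)
    simp [override, this]
  simp only [applyGate, addQubit, PiLp.toLp_apply, h]
  split_ifs with hg
  · rfl
  · simp

theorem extendQ_injOn {V V' : Finset ℕ} (θ : V ≃ V') {x y : ℕ} (hx : x ∈ V) (hy : y ∈ V)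
    (h : extendQ θ x = extendQ θ y) : x = y := by
  simp only [extendQ, hx, hy, dif_pos] at h
  simpa using θ.injective (Subtype.ext h)

theorem extendQ_mem {V V' : Finset ℕ} (θ : V ≃ V') {x : ℕ} (hx : x ∈ V) : extendQ θ x ∈ V' := by
  simp [extendQ, hx]

/-- The extension of a bijection of quantum variables by one fresh variable. -/
theorem exists_equiv_insert {V V' : Finset ℕ} (θ : V ≃ V') {r s : ℕ} (hr : r ∉ V) (hs : s ∉ V') :
    ∃ θ' : (insert r V : Finset ℕ) ≃ (insert s V' : Finset ℕ),
      (θ' ⟨r, Finset.mem_insert_self r V⟩ : ℕ) = s ∧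
        ∀ q : V, (θ' ⟨q, Finset.mem_insert_of_mem q.2⟩ : ℕ) = θ q := by
  have hf : ∀ x ∈ insert r V, Function.update (extendQ θ) r s x ∈ insert s V' := by
    intro x hx
    by_cases h : x = r
    · simp [h]
    · have hxV : x ∈ V := by simpa [h] using hx
      simp [h, extendQ_mem θ hxV]
  let F : {x // x ∈ insert r V} → {x // x ∈ insert s V'} := fun x => ⟨_, hf x x.2⟩
  have hinj : Function.Injective F := by
    rintro ⟨x, hx⟩ ⟨y, hy⟩ hxy
    have hxy : Function.update (extendQ θ) r s x = Function.update (extendQ θ) r s y :=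
      congr_arg Subtype.val hxy
    refine Subtype.ext ?_
    change x = y
    rw [Finset.mem_insert] at hx hy
    by_cases h1 : x = r <;> by_cases h2 : y = r
    · rw [h1, h2]
    · have hy := hy.resolve_left h2
      simp only [h1, Function.update_self, Function.update_of_ne h2] at hxy
      exact absurd (hxy ▸ extendQ_mem θ hy) hs
    · have hx := hx.resolve_left h1
      simp only [h2, Function.update_self, Function.update_of_ne h1] at hxy
      exact absurd (hxy ▸ extendQ_mem θ hx) hs
    · rw [Function.update_of_ne h1, Function.update_of_ne h2] at hxy
      exact extendQ_injOn θ (hx.resolve_left h1) (hy.resolve_left h2) hxy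
  have hcard : Fintype.card (insert r V : Finset ℕ) = Fintype.card (insert s V' : Finset ℕ) := by
    have := Fintype.card_congr θ
    simp only [Fintype.card_coe] at this ⊢
    rw [Finset.card_insert_of_notMem hr, Finset.card_insert_of_notMem hs, this]
  refine ⟨Equiv.ofBijective F ((Fintype.bijective_iff_injective_and_card F).2 ⟨hinj, hcard⟩),
    ?_, fun q => ?_⟩
  · simp [F]
  · have : (q : ℕ) ≠ r := fun h => hr (h ▸ q.2)
    simp [F, this, extendQ]

theorem StepIn.equivariant {G : GateFamily} {S : Set Label} {c c' d : PreConfig}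
    (h : StepIn G S c d) (hc : c.Ok) (he : c.Equivalent c') :
    ∃ d', StepIn G S c' d' ∧ d.Equivalent d' := by
  have hd := h.ok hc
  obtain ⟨V, φ, M⟩ := c
  obtain ⟨W, ψ, N⟩ := c'
  obtain ⟨V', φ', M'⟩ := d
  obtain ⟨a, h, hreg⟩ : ∃ a, Ctx (RootIn S a) M M' ∧ RegStep G a V φ V' φ' := h
  obtain ⟨θ, rfl, rfl⟩ : ∃ θ : V ≃ W, ψ = mapHilb θ φ ∧ N = M.mapQ (extendQ θ) := he
  cases hreg with
  | id =>
    exact ⟨⟨W, mapHilb θ φ, M'.mapQ (extendQ θ)⟩, ⟨_, h.mapQ _, .id _ _⟩, θ, rfl, rfl⟩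
  | gate _ hr hU =>
    refine ⟨⟨W, _, M'.mapQ (extendQ θ)⟩, ⟨_, h.mapQ _,
      .gate _ (fun i => extendQ_mem θ (hr i)) hU⟩, θ, ?_, rfl⟩
    exact applyGate_mapHilb _ θ hr _ (fun i => by simp [extendQ, hr i]) φ
  | @new _ _ b r hr =>
    -- The name `r` may already be taken in `W`, so another fresh name is used and the bijection is
    -- extended by `r ↦ s`.
    obtain ⟨s, hs⟩ := Infinite.exists_notMem_finset W
    obtain ⟨θ', h1, h2⟩ := exists_equiv_insert θ hr hs
    have h' := h.mapQ (extendQ θ')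
    have h3 : extendQ θ' r = s := by simp [extendQ, h1]
    have h4 : M.mapQ (extendQ θ') = M.mapQ (extendQ θ) := mapQ_congr fun q hq => by
      have hqV : q ∈ V := hc.1 hq
      have := h2 ⟨q, hqV⟩
      simp only at this
      simp [extendQ, hqV, this]
    rw [h4, Act.map, h3] at h'
    exact ⟨⟨insert s W, _, M'.mapQ (extendQ θ')⟩, ⟨_, h', .new _ b hs⟩, θ',
      addQubit_mapHilb θ θ' h1 h2 φ b, rfl⟩

/-! ### Permutation of reductions -/

/-- An `r`-step passes a chain of `s`-steps one by one: the steps it has passed may multiply, but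
they are behind it, and it stays a single step. -/
theorem exists_permutation {X : Type*} {r s : X → X → Prop}
    (h : ∀ a b c, r a b → s b c → ∃ d, ReflTransGen s a d ∧ r d c) {a b : X}
    (hab : ReflTransGen (fun a b => r a b ∨ s a b) a b) :
    ∃ c, ReflTransGen s a c ∧ ReflTransGen r c b := by
  have h1 : ∀ {a b c}, r a b → ReflTransGen s b c → ∃ d, ReflTransGen s a d ∧ r d c := by
    intro a b c hr hs
    induction hs with
    | refl => exact ⟨a, .refl, hr⟩
    | tail _ hs ih =>
      obtain ⟨d, h2, h3⟩ := ih
      obtain ⟨e, h4, h5⟩ := h _ _ _ h3 hs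
      exact ⟨e, h2.trans h4, h5⟩
  induction hab using ReflTransGen.head_induction_on with
  | refl => exact ⟨b, .refl, .refl⟩
  | head h' _ ih =>
    obtain ⟨c, h2, h3⟩ := ih
    rcases h' with hr | hs
    · obtain ⟨d, h4, h5⟩ := h1 hr h2
      exact ⟨d, h4, .head h5 h3⟩
    · exact ⟨c, .head hs h2, h3⟩

/-- Well-formed preconfigurations. -/
abbrev OkPreConfig : Type := {c : PreConfig // c.Ok}

/-- Reduction of well-formed preconfigurations by a rule with label in `S`. -/
def OkStep (G : GateFamily) (S : Set Label) (c d : OkPreConfig) : Prop := StepIn G S c.1 d.1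

theorem Ctx.exists_root {R : Term → Term → Prop} {M M' : Term} (h : Ctx R M M') :
    ∃ N N', R N N' := by
  induction h with
  | root hr => exact ⟨_, _, hr⟩
  | _ => assumption

theorem Ctx.act_eq_id {a : Act} {M M' : Term} (h : Ctx (RootIn classicalLabels a) M M') :
    a = .id := by
  obtain ⟨N, N', α, hα, hr⟩ := h.exists_root
  cases hr <;> simp [classicalLabels] at *

theorem rtg_classical_okStep {G : GateFamily} {V : Finset ℕ} {φ : Hilb V} {M M' : Term}
    (h : ReflTransGen Classical M M') (hM : PreConfig.Ok ⟨V, φ, M⟩) :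
    ∃ hM' : PreConfig.Ok ⟨V, φ, M'⟩,
      ReflTransGen (OkStep G classicalLabels) ⟨_, hM⟩ ⟨_, hM'⟩ := by
  induction h with
  | refl => exact ⟨hM, .refl⟩
  | @tail A B _ h ih =>
    obtain ⟨hA, ih⟩ := ih
    have hs : StepIn G classicalLabels ⟨V, φ, A⟩ ⟨V, φ, B⟩ := ⟨.id, h, .id _ _⟩
    exact ⟨hs.ok hA, ih.tail hs⟩

theorem OkStep.permute_classical {G : GateFamily} {c d e : OkPreConfig}
    (h₁ : OkStep G nonClassicalLabels c d) (h₂ : OkStep G classicalLabels d e) :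
    ∃ d', ReflTransGen (OkStep G classicalLabels) c d' ∧ OkStep G nonClassicalLabels d' e := by
  obtain ⟨⟨V, φ, M⟩, hc⟩ := c
  obtain ⟨⟨W, ψ, N⟩, hd⟩ := d
  obtain ⟨⟨W', χ, P⟩, he⟩ := e
  obtain ⟨a, h₁, hreg⟩ := h₁
  obtain ⟨b, h₂, hreg'⟩ := h₂
  obtain rfl := h₂.act_eq_id
  cases hreg'
  obtain ⟨M', h, h'⟩ := Classical.permute (PreConfig.ok_iff.1 hc).2.1 h₁ h₂
  obtain ⟨hM', h⟩ := rtg_classical_okStep h hc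
  exact ⟨_, h, a, h', hreg⟩

theorem OkStep.permute_new {G : GateFamily} {c d e : OkPreConfig}
    (h₁ : OkStep G quantumLabels c d) (h₂ : OkStep G {.new} d e) :
    ∃ d', OkStep G {.new} c d' ∧ OkStep G quantumLabels d' e := by
  obtain ⟨⟨V, φ, M⟩, hc⟩ := c
  obtain ⟨⟨W, ψ, N⟩, hd⟩ := d
  obtain ⟨⟨W', χ, P⟩, he⟩ := e
  obtain ⟨a, h₁, hreg⟩ := h₁
  obtain ⟨b, h₂, hreg'⟩ := h₂
  obtain ⟨_, rfl, h₂⟩ := ctx_rootIn_iff.1 h₂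
  obtain ⟨b, s, rfl⟩ : ∃ c s, b = .new c s := by
    obtain ⟨N, N', hr⟩ := h₂.exists_root
    cases hr
    exact ⟨_, _, rfl⟩
  obtain ⟨M', h, h'⟩ := Quantum.permute_new (PreConfig.ok_iff.1 hc).2.1 h₁ h₂
  replace h := ctx_rootIn_iff.2 ⟨_, Set.mem_singleton _, h⟩
  simp only at hreg hreg'
  cases hreg' with | new _ _ hs =>
  cases hreg with
  | id =>
    have hs : StepIn G {.new} ⟨V, φ, M⟩ ⟨insert s V, addQubit φ s b, M'⟩ := ⟨_, h, .new _ _ hs⟩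
    exact ⟨⟨_, hs.ok hc⟩, hs, _, h', .id _ _⟩
  | gate _ hr hU =>
    have hst : StepIn G {.new} ⟨V, φ, M⟩ ⟨insert s V, addQubit φ s b, M'⟩ := ⟨_, h, .new _ _ hs⟩
    refine ⟨⟨_, hst.ok hc⟩, hst, _, h', ?_⟩
    simp only [← applyGate_addQubit _ hr hs]
    exact .gate _ _ hU
  | new =>
    obtain ⟨N, N', α, hα, hr⟩ := h₁.exists_root
    cases hr
    simp [quantumLabels] at hα

theorem OkStep.red {G : GateFamily} {S : Set Label} {c d : OkPreConfig} (h : OkStep G S c d) :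
    RedIn G S ⟦c⟧ ⟦d⟧ := by
  obtain ⟨α, hα, h⟩ := stepIn_iff.1 h
  exact ⟨α, hα, c, d, rfl, rfl, h.step c.2⟩

/-- A reduction can start from any representative. Hence a whole computation lifts to
preconfigurations, where the exchanges are carried out. -/
theorem RedIn.exists_okStep {G : GateFamily} {S : Set Label} {C D : Config} (h : RedIn G S C D)
    (c : OkPreConfig) (hc : ⟦c⟧ = C) : ∃ d : OkPreConfig, ⟦d⟧ = D ∧ OkStep G S c d := by
  obtain ⟨α, hα, c', d', hc', rfl, h⟩ := h
  have he : c'.1.Equivalent c.1 := Quotient.exact (hc'.trans hc.symm)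
  have hs : StepIn G S c'.1 d'.1 := stepIn_iff.2 ⟨α, hα, h.stepIn⟩
  obtain ⟨d, h1, h2⟩ := hs.equivariant c'.2 he
  exact ⟨⟨d, h1.ok c.2⟩, (Quotient.sound (s := configSetoid) h2).symm, h1⟩

/-! ### The kinds of reductions are disjoint -/

theorem StepIn.card_qv {G : GateFamily} {S : Set Label} (hS : Label.new ∉ S) {c d : PreConfig}
    (h : StepIn G S c d) : d.qv.card = c.qv.card := by
  obtain ⟨V, φ, M⟩ := c
  obtain ⟨V', φ', M'⟩ := d
  obtain ⟨a, h, hreg⟩ := h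
  cases hreg with
  | new =>
    obtain ⟨N, N', α, hα, hr⟩ := h.exists_root
    cases hr
    exact absurd hα hS
  | _ => rfl

theorem StepIn.card_qv_new {G : GateFamily} {c d : PreConfig}
    (h : StepIn G {.new} c d) : d.qv.card = c.qv.card + 1 := by
  obtain ⟨V, φ, M⟩ := c
  obtain ⟨V', φ', M'⟩ := d
  obtain ⟨a, h, hreg⟩ := h
  obtain ⟨N, N', α, hα, hr⟩ := h.exists_root
  obtain rfl := hα
  cases hr
  cases hreg with | new _ _ hr => exact Finset.card_insert_of_notMem hr

theorem RedIn.exists_common {G : GateFamily} {S T : Set Label} {C D : Config}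
    (h : RedIn G S C D) (h' : RedIn G T C D) :
    ∃ c d d' : OkPreConfig, OkStep G S c d ∧ OkStep G T c d' ∧ d.1.Equivalent d'.1 := by
  obtain ⟨c, hc⟩ := Quotient.exists_rep C
  obtain ⟨d, hd, h1⟩ := h.exists_okStep c hc
  obtain ⟨d', hd', h2⟩ := h'.exists_okStep c hc
  exact ⟨c, d, d', h1, h2, Quotient.exact (hd.trans hd'.symm)⟩

/-- The number of quantum variables is invariant under renaming, and only `new` changes it. -/
theorem RedIn.not_new {G : GateFamily} {S : Set Label} (hS : Label.new ∉ S) {C D : Config}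
    (h : RedIn G S C D) : ¬ RedIn G {.new} C D := by
  intro h'
  obtain ⟨c, d, d', h1, h2, θ, -⟩ := h.exists_common h'
  have h3 := StepIn.card_qv hS h1
  have h4 := StepIn.card_qv_new h2
  have h5 := Fintype.card_congr θ
  simp only [Fintype.card_coe] at h5
  omega

/-- The two results agree only up to renaming, so all quantum variables are first identified, which
makes the terms equal. Linearity of quantum variables is lost, but linearity of patterns survives
and is all that the comparison of terms needs. -/
theorem RedIn.classical_not_quantum {G : GateFamily} {C D : Config}
    (h : RedIn G classicalLabels C D) : ¬ RedIn G quantumLabels C D := by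
  intro h'
  obtain ⟨c, d, d', ⟨a, h1, -⟩, ⟨b, h2, -⟩, θ, -, he⟩ := h.exists_common h'
  obtain ⟨α, hα, h1⟩ := ctx_rootIn_iff.1 (h1.mapQ fun _ => 0)
  obtain ⟨β, hβ, h2⟩ := ctx_rootIn_iff.1 (h2.mapQ fun _ => 0)
  refine Ctx.classical_ne_quantum hβ hα ((PreConfig.ok_iff.1 c.2).2.1.mapQ _) h1 h2 ?_
  rw [he, mapQ_mapQ]
  rfl

theorem RedIn.classical_not_nonClassical {G : GateFamily} {C D : Config}
    (h : RedIn G classicalLabels C D) : ¬ RedIn G nonClassicalLabels C D := by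
  rintro ⟨α, hα | hα, h'⟩
  · exact h.classical_not_quantum ⟨α, hα, h'⟩
  · exact h.not_new (by simp [classicalLabels]) ⟨α, hα, h'⟩

/-! ## Standardization -/

theorem exists_seq {X : Type*} {r : X → X → Prop} {a b : X} (h : ReflTransGen r a b) :
    ∃ (n : ℕ) (f : ℕ → X), f 0 = a ∧ f n = b ∧ ∀ i < n, r (f i) (f (i + 1)) := by
  induction h using ReflTransGen.head_induction_on with
  | refl => exact ⟨0, fun _ => b, rfl, rfl, by simp⟩
  | @head a c hac _ ih =>
    obtain ⟨n, f, h0, hn, hf⟩ := ih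
    refine ⟨n + 1, fun i => i.casesOn a f, rfl, hn, fun i hi => ?_⟩
    cases i with
    | zero => subst h0; exact hac
    | succ i => exact hf i (by omega)

theorem exists_concat {X : Type*} (f g : ℕ → X) (n : ℕ) (h : f n = g 0) :
    ∃ k : ℕ → X, (∀ i ≤ n, k i = f i) ∧ ∀ i, k (n + i) = g i := by
  refine ⟨fun i => if i ≤ n then f i else g (i - n), fun i hi => by simp [hi], fun i => ?_⟩
  cases i with
  | zero => simp [h]
  | succ i => simp

theorem exists_standard_seq {G : GateFamily} {c d : OkPreConfig}
    (h : ReflTransGen (OkStep G Set.univ) c d) :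
    ∃ (n m l : ℕ) (f : ℕ → Config), f 0 = ⟦c⟧ ∧ f (n + (m + l)) = ⟦d⟧ ∧
      (∀ i < n, RedIn G classicalLabels (f i) (f (i + 1))) ∧
      (∀ i < m, RedIn G {.new} (f (n + i)) (f (n + i + 1))) ∧
      ∀ i < l, RedIn G quantumLabels (f (n + (m + i))) (f (n + (m + i) + 1)) := by
  have h1 : ReflTransGen (fun c d => OkStep G nonClassicalLabels c d ∨
      OkStep G classicalLabels c d) c d := ReflTransGen.mono (fun c d h => by
    obtain ⟨α, -, h⟩ := stepIn_iff.1 h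
    by_cases hα : α ∈ nonClassicalLabels
    · exact Or.inl (h.mono (by simpa using hα))
    · refine Or.inr (h.mono ?_)
      cases α <;> simp [nonClassicalLabels, quantumLabels, classicalLabels] at *) _ _ h
  obtain ⟨x, hcx, hxd⟩ := exists_permutation (fun _ _ _ => OkStep.permute_classical) h1
  have h2 : ReflTransGen (fun c d => OkStep G quantumLabels c d ∨ OkStep G {.new} c d) x d :=
    ReflTransGen.mono (fun c d h => by
      obtain ⟨α, hα | hα, h⟩ := stepIn_iff.1 h
      · exact Or.inl (h.mono (by simpa using hα))
      · exact Or.inr (h.mono (by simpa using hα))) _ _ hxd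
  obtain ⟨y, hxy, hyd⟩ := exists_permutation (fun _ _ _ h h' => by
    obtain ⟨d, h1, h2⟩ := OkStep.permute_new h h'
    exact ⟨d, .single h1, h2⟩) h2
  obtain ⟨n, f, f0, fn, hf⟩ := exists_seq hcx
  obtain ⟨m, g, g0, gm, hg⟩ := exists_seq hxy
  obtain ⟨l, k, k0, kl, hk⟩ := exists_seq hyd
  obtain ⟨p, hp1, hp2⟩ := exists_concat g k m (gm.trans k0.symm)
  have p0 : p 0 = x := (hp1 0 (Nat.zero_le m)).trans g0
  obtain ⟨q, hq1, hq2⟩ := exists_concat f p n (fn.trans p0.symm)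
  refine ⟨n, m, l, fun i => ⟦q i⟧, ?_, ?_, fun i hi => ?_, fun i hi => ?_, fun i hi => ?_⟩
  · simp only [hq1 0 (Nat.zero_le n), f0]
  · simp only [hq2, hp2, kl]
  · simp only [hq1 i hi.le, hq1 (i + 1) hi]
    exact (hf i hi).red
  · simp only [add_assoc, hq2, hp1 i hi.le, hp1 (i + 1) hi]
    exact (hg i hi).red
  · simp only [add_assoc, hq2, hp2]
    exact (hk i hi).red

theorem RedIn.mono {G : GateFamily} {S T : Set Label} (hST : S ⊆ T) {C D : Config}
    (h : RedIn G S C D) : RedIn G T C D :=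
  h.imp fun _ h => ⟨hST h.1, h.2⟩

end QCalculus
end

theorem mainTheorem4 (G : QCalculus.GateFamily) (len : ℕ) (C : ℕ → QCalculus.Config)
    (hC : QCalculus.IsComputation G (len : ℕ∞) C) :
    ∃ (len' : ℕ) (C' : ℕ → QCalculus.Config),
      QCalculus.IsCNQ G (len' : ℕ∞) C' ∧ C' 0 = C 0 ∧ C' (len' - 1) = C (len - 1) := by
  open QCalculus in
  obtain ⟨-, hred, hlast⟩ := hC
  obtain ⟨t, ht, hnf⟩ := hlast.resolve_left (ENat.natCast_ne_top len)
  obtain rfl : len = t + 1 := by exact_mod_cast ht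
  -- Representatives are chosen along the computation so that each reduces to the next.
  have hlift : ∀ (c : OkPreConfig), ⟦c⟧ = C 0 → ∀ i ≤ t, ∃ d : OkPreConfig, ⟦d⟧ = C i ∧
      Relation.ReflTransGen (OkStep G Set.univ) c d := by
    intro c hc i
    induction i with
    | zero => exact fun _ => ⟨c, hc, .refl⟩
    | succ i ih =>
      intro hi
      obtain ⟨d, hd, h⟩ := ih (by omega)
      obtain ⟨e, he, h'⟩ := (hred i (by exact_mod_cast Nat.lt_succ_of_le hi)).exists_okStep d hd
      exact ⟨e, he, h.tail h'⟩
  obtain ⟨c, hc⟩ := Quotient.exists_rep (C 0)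
  obtain ⟨d, hd, h⟩ := hlift c hc t le_rfl
  obtain ⟨n, m, l, f, f0, fd, hcl, hnew, hqu⟩ := exists_standard_seq h
  have hnew' : ∀ i, n ≤ i → i < n + m → RedIn G {.new} (f i) (f (i + 1)) := fun i h1 h2 => by
    obtain ⟨j, rfl⟩ := Nat.exists_eq_add_of_le h1
    exact hnew j (by omega)
  have hqu' : ∀ i, n + m ≤ i → i < n + (m + l) → RedIn G quantumLabels (f i) (f (i + 1)) :=
    fun i h1 h2 => by
      obtain ⟨j, rfl⟩ := Nat.exists_eq_add_of_le h1
      rw [add_assoc n m j]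
      exact hqu j (by omega)
  have hlt : ∀ i j : ℕ, ((i + j : ℕ) : ℕ∞) < ((n + (m + l) + 1 : ℕ) : ℕ∞) →
      i + j < n + (m + l) + 1 := fun i j h => by exact_mod_cast h
  refine ⟨n + (m + l) + 1, f, ⟨⟨by exact_mod_cast Nat.succ_pos _, fun i hi => ?_,
    Or.inr ⟨_, rfl, ?_⟩⟩, fun i hi hr => ?_, fun i hi hr => ?_⟩, f0.trans hc, ?_⟩
  · have := hlt i 1 hi
    by_cases h1 : i < n
    · exact (hcl i h1).mono (Set.subset_univ _)
    · by_cases h2 : i < n + m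
      · exact (hnew' i (by omega) h2).mono (Set.subset_univ _)
      · exact (hqu' i (by omega) (by omega)).mono (Set.subset_univ _)
  · rw [fd, hd]
    exact hnf
  · have := hlt i 2 hi
    -- The premise only says that some non classical reduction links the two configurations; before
    -- index `n` this is excluded because a classical one does.
    by_cases h1 : i < n
    · exact absurd hr (hcl i h1).classical_not_nonClassical
    · by_cases h2 : i + 1 < n + m
      · exact (hnew' (i + 1) (by omega) h2).mono Set.subset_union_right
      · exact (hqu' (i + 1) (by omega) (by omega)).mono Set.subset_union_left
  · have := hlt i 2 hi
    by_cases h1 : i < n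
    · exact absurd hr (hcl i h1).classical_not_quantum
    -- In the middle segment a quantum reduction would link configurations that differ in their
    -- number of quantum variables.
    · by_cases h2 : i < n + m
      · exact absurd (hnew' i (by omega) h2) (hr.not_new (by simp [quantumLabels]))
      · exact hqu' (i + 1) (by omega) (by omega)
  · rw [Nat.add_sub_cancel, Nat.add_sub_cancel, fd, hd]
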